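/- Let $n\ge 1$ be an integer and $L>0$, and put $\lambda_n=n^2\pi^2/L^2$. For $a\in L^1(0,L)$ write $\lambda_n\prec a$ if $\lambda_n\le a(x)$ for a.e. $x\in(0,L)$ and $\lambda_n<a(x)$ on a set of positive measure. For $a\in L^1(0,L)$ consider the Neumann problem $$u''(x)+a(x)u(x)=0,\quad x\in(0,L),\qquad u'(0)=u'(L)=0, \tag{N}$$ where a solution is a function $u\in H^1(0,L)$ such that $\int_0^L u'v'\,dx=\int_0^L a\,u\,v\,dx$ for all $v\in H^1(0,L)$. Let $\Lambda_n$ be the set of all $a\in L^1(0,L)$ with $\lambda_n\prec a$ for which (N) has a nontrivial solution, and let $$\beta_{1,n}=\inf_{a\in\Lambda_n}\|a-\lambda_n\|_{L^1(0,L)}.$$ For $a\in L^1(0,L)$ with $\lambda_n\prec a$ consider the two conditions (G) $\ \|a-\lambda_n\|_{L^1(0,L)}<\beta_{1,n}$; (P) there are numbers $0=y_0<y_1<\dots<y_{2n+1}<y_{2n+2}=L$ such that, for all $0\le i\le 2n+1$, $$y_{i+1}-y_i<\frac{L}{2n}\qquad\text{and}\qquad \|a-\lambda_n\|_{L^1(y_i,y_{i+1})}<\frac{n\pi}{L}\cot\frac{n\pi(y_{i+1}-y_i)}{L}.$$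 Then: 1. If $a\in L^1(0,L)$, $\lambda_n\prec a$ and $a$ satisfies (P), then the only solution of (N) is the trivial one. 2. If $a\in L^1(0,L)$, $\lambda_n\prec a$ and $a$ satisfies (G), then $a$ satisfies (P). 3. If $0=y_0<y_1<\dots<y_{2n+1}<y_{2n+2}=L$ are any numbers with $y_{k+1}-y_k<\frac{L}{2n}$ for all $0\le k\le 2n+1$ and $y_{i+1}-y_i\ne y_{j+1}-y_j$ for some $0\le i,j\le 2n+1$, then there is $a\in L^1(0,L)$ with $\lambda_n\prec a$ that satisfies (P), with these same numbers $y_0,\dots,y_{2n+2}$, but does not satisfy (G). -/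

import Mathlib

open MeasureTheory Set
open scoped ContDiff

noncomputable section

namespace NeumannLyapunov

/-- `λ_n = n² π² / L²`, the `n`-th eigenvalue of the Neumann problem
`u'' + λ u = 0` on `(0, L)`, `u'(0) = u'(L) = 0`. -/
def neumannEigenvalue (n : ℕ) (L : ℝ) : ℝ := (n : ℝ) ^ 2 * Real.pi ^ 2 / L ^ 2

/-- `c ≺ d` on `(0, L)`: `c ≤ d` almost everywhere in `(0, L)`, and `c < d` on a subset of `(0, L)`
of positive Lebesgue measure. -/
def Prec (L : ℝ) (c d : ℝ → ℝ) : Prop :=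
  (∀ᵐ x ∂(volume.restrict (Ioo 0 L)), c x ≤ d x) ∧ 0 < volume {x | x ∈ Ioo 0 L ∧ c x < d x}

/-- The function `g` is a weak derivative of `u` on the interval `(0, L)`:
`∫ u φ' = - ∫ g φ` for every `φ ∈ C_c^∞(0, L)`. -/
def IsWeakDeriv (L : ℝ) (u g : ℝ → ℝ) : Prop :=
  ∀ φ : ℝ → ℝ, ContDiff ℝ ∞ φ → HasCompactSupport φ → tsupport φ ⊆ Ioo 0 L →
    ∫ x in Ioo 0 L, u x * deriv φ x = -∫ x in Ioo 0 L, g x * φ x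

/-- `u` belongs to the Sobolev space `H¹(0, L)` and `g` is its weak derivative. -/
structure IsSobolevWith (L : ℝ) (u g : ℝ → ℝ) : Prop where
  memLp : MemLp u 2 (volume.restrict (Ioo 0 L))
  memLp_deriv : MemLp g 2 (volume.restrict (Ioo 0 L))
  weakDeriv : IsWeakDeriv L u g

/-- `u ∈ H¹(0, L)` is a (weak) solution of the Neumann problem
`u'' + a u = 0` on `(0, L)`, `u'(0) = u'(L) = 0`, that is,
`∫ u' v' = ∫ a u v` for all `v ∈ H¹(0, L)`. -/
def IsNeumannSolution (L : ℝ) (a u : ℝ → ℝ) : Prop :=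
  ∃ u' : ℝ → ℝ, IsSobolevWith L u u' ∧
    ∀ v v' : ℝ → ℝ, IsSobolevWith L v v' →
      ∫ x in Ioo 0 L, u' x * v' x = ∫ x in Ioo 0 L, a x * u x * v x

/-- `u` is the zero element of `H¹(0, L)`. -/
def IsTrivial (L : ℝ) (u : ℝ → ℝ) : Prop := ∀ᵐ x ∂(volume.restrict (Ioo 0 L)), u x = 0

/-- The norm of `f` in `L¹(c, d)`. It is only used for integrable `f` (see `Admissible`). -/
def normL1 (c d : ℝ) (f : ℝ → ℝ) : ℝ := ∫ x in Ioo c d, |f x|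

/-- `a ∈ L¹(0, L)` and `λ_n ≺ a`. -/
def Admissible (n : ℕ) (L : ℝ) (a : ℝ → ℝ) : Prop :=
  IntegrableOn a (Ioo 0 L) ∧ Prec L (fun _ => neumannEigenvalue n L) a

/-- The set `Λ_n` of all `a ∈ L¹(0, L)` with `λ_n ≺ a` whose Neumann problem has a nontrivial
solution. -/
def resonantSet (n : ℕ) (L : ℝ) : Set (ℝ → ℝ) :=
  {a | Admissible n L a ∧ ∃ u : ℝ → ℝ, IsNeumannSolution L a u ∧ ¬ IsTrivial L u}

/-- The Lyapunov constant `β_{1,n}`, the infimum of `‖a - λ_n‖_{L¹(0, L)}` over `a ∈ Λ_n`.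
For `n ≥ 1` and `L > 0` it is the infimum of a set that is bounded below by `0` and that contains
the value for the constant function `a = λ_{n+1}`. -/
def lyapunovConst (n : ℕ) (L : ℝ) : ℝ :=
  sInf ((fun a : ℝ → ℝ => normL1 0 L (fun x => a x - neumannEigenvalue n L)) '' resonantSet n L)

/-- `a ∈ L¹(0, L)`, `λ_n ≺ a` and `‖a - λ_n‖_{L¹(0, L)} < β_{1,n}`. -/
def GlobalCondition (n : ℕ) (L : ℝ) (a : ℝ → ℝ) : Prop :=
  Admissible n L a ∧ normL1 0 L (fun x => a x - neumannEigenvalue n L) < lyapunovConst n L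

/-- `0 = y_0 < y_1 < ⋯ < y_{2n+2} = L` with all gaps smaller than `L / (2n)`. -/
structure IsFinePartition (n : ℕ) (L : ℝ) (y : Fin (2 * n + 3) → ℝ) : Prop where
  zero : y 0 = 0
  last : y (Fin.last (2 * n + 2)) = L
  strictMono : StrictMono y
  gap_lt : ∀ i : Fin (2 * n + 2), y i.succ - y i.castSucc < L / (2 * (n : ℝ))

/-- On each piece of the partition `y`,
`‖a - λ_n‖_{L¹(y_i, y_{i+1})} < (nπ/L) cot (nπ (y_{i+1} - y_i) / L)`. -/
def SmallOnPieces (n : ℕ) (L : ℝ) (y : Fin (2 * n + 3) → ℝ) (a : ℝ → ℝ) : Prop :=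
  ∀ i : Fin (2 * n + 2),
    normL1 (y i.castSucc) (y i.succ) (fun x => a x - neumannEigenvalue n L) <
      (n : ℝ) * Real.pi / L * Real.cot ((n : ℝ) * Real.pi * (y i.succ - y i.castSucc) / L)

/-- The partition condition: some partition as in `IsFinePartition` satisfies `SmallOnPieces`. -/
def PartitionCondition (n : ℕ) (L : ℝ) (a : ℝ → ℝ) : Prop :=
  ∃ y : Fin (2 * n + 3) → ℝ, IsFinePartition n L y ∧ SmallOnPieces n L y a

end NeumannLyapunov

end

/-!
Write `ν = n π / L`, so that the eigenvalue is `ν²`, and let `B` be the sum of `ν cot (ν d)` over the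
partition of `(0, L)` into `2n + 2` equal pieces of length `d` (`equalPartitionBound`).

*The partition condition forces `u = 0`.* A weak solution `u` with derivative `W` solves
`u' = W`, `W' = -a u` with `W 0 = W L = 0` (`IsNeumannSolution.exists_isSystemSolution`). The
Wronskian with a sine, evaluated between a zero of a nontrivial `u` and a point where `|u|` is
maximal, shows that a piece satisfying the bound cannot contain both a zero of `u` and a zero of `W`
(`IsSystemSolution.eq_zero_of_disfocal`). On the other hand, since `a ≥ ν²`, Sturm comparison
produces alternating zeros of `W` and `u`, starting at `0`, with consecutive distances at most
`L / (2n)`; because `a` is not `ν²` almost everywhere, the zero of `W` reached after `2n` steps lies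
before `L`. As `W L = 0`, one more zero of `u` lies in between. These `2n + 3` alternating points in
`[0, L]` cannot be accommodated by `2n + 2` pieces none of which contains two consecutive ones
(`exists_alternating_point`, `isTrivial_of_partitionCondition`).

*The Lyapunov constant is at most `B`* (`lyapunovConst_le`). The minimizing sequence is explicit:
`u = sin (ρ arcsin (r cos (κ x)))` with `κ = (n + 1) π / L` and `ρ = n / (n + 1)` is smooth and
satisfies the Neumann conditions, and `a = -u'' / u > ν²` has mass tending to `B` as `r → 1`, where
`a - ν²` concentrates at the extrema of `cos (κ x)`. This is the only information on the Lyapunov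
constant that the other two claims use.

*Total mass below `B` yields a partition* (`partitionCondition_of_normL1_lt`). Pieces are chosen
greedily, each carrying exactly the mass `ν cot (ν d)`; by convexity of the cotangent, `2n + 2` of
them cannot fit into `[0, L]`, and truncating the resulting points at `L` gives the partition.

*An unequal partition allows mass `B`* (`exists_admissible_smallOnPieces`). Strict convexity makes
the sum of the bounds over the pieces exceed `B`, which leaves room for a step function of total mass
exactly `B` below the bound on every piece.
-/

open MeasureTheory Set
open scoped ContDiff

noncomputable section

namespace NeumannLyapunov

/-! ### Primitives of integrable functions -/

/-- `F` is absolutely continuous on `[a, b]` with almost everywhere derivative `f`, expressed by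
the integral formula `F x = F a + ∫ a..x, f` with `f` integrable. -/
structure IsPrimitiveOn (a b : ℝ) (F f : ℝ → ℝ) : Prop where
  intervalIntegrable : IntervalIntegrable f volume a b
  eq_add_integral : ∀ x ∈ Icc a b, F x = F a + ∫ t in a..x, f t

namespace IsPrimitiveOn

variable {a b : ℝ} {F f G g : ℝ → ℝ}

lemma intervalIntegrable_sub (h : IsPrimitiveOn a b F f) {x y : ℝ} (hx : x ∈ Icc a b)
    (hy : y ∈ Icc a b) : IntervalIntegrable f volume x y := by
  refine h.intervalIntegrable.mono_set ?_
  rw [uIcc_of_le (hx.1.trans hx.2)]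
  exact uIcc_subset_Icc hx hy

lemma integral_eq (h : IsPrimitiveOn a b F f) {x y : ℝ} (hx : x ∈ Icc a b) (hy : y ∈ Icc a b) :
    ∫ t in x..y, f t = F y - F x := by
  have ha : a ∈ Icc a b := ⟨le_rfl, hx.1.trans hx.2⟩
  rw [h.eq_add_integral x hx, h.eq_add_integral y hy,
    ← intervalIntegral.integral_add_adjacent_intervals (h.intervalIntegrable_sub ha hx)
      (h.intervalIntegrable_sub hx hy)]
  ring

lemma mono (h : IsPrimitiveOn a b F f) {c d : ℝ} (hc : c ∈ Icc a b) (hd : d ∈ Icc a b) :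
    IsPrimitiveOn c d F f where
  intervalIntegrable := h.intervalIntegrable_sub hc hd
  eq_add_integral x hx := by
    rw [h.integral_eq hc ⟨hc.1.trans hx.1, hx.2.trans hd.2⟩]
    ring

lemma absolutelyContinuous (h : IsPrimitiveOn a b F f) (hab : a ≤ b) :
    AbsolutelyContinuousOnInterval F a b := by
  have h1 := (h.intervalIntegrable.absolutelyContinuousOnInterval_intervalIntegral
    (c := a) (by simp))
  have hc : AbsolutelyContinuousOnInterval (fun _ : ℝ => F a) a b :=
    ((LipschitzWith.const (F a)).lipschitzOnWith).absolutelyContinuousOnInterval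
  have h2 := hc.add h1
  rw [absolutelyContinuousOnInterval_iff] at h2 ⊢
  intro ε hε
  obtain ⟨δ, hδ, H⟩ := h2 ε hε
  refine ⟨δ, hδ, fun E hE hlt => ?_⟩
  convert H E hE hlt using 1
  refine Finset.sum_congr rfl fun i hi => ?_
  have := hE.1 i hi
  rw [uIcc_of_le hab] at this
  simp only [Pi.add_apply]
  rw [h.eq_add_integral _ this.1, h.eq_add_integral _ this.2]

lemma continuousOn (h : IsPrimitiveOn a b F f) (hab : a ≤ b) : ContinuousOn F (Icc a b) := by
  simpa [uIcc_of_le hab] using (h.absolutelyContinuous hab).continuousOn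

lemma ae_hasDerivAt (h : IsPrimitiveOn a b F f) :
    ∀ᵐ x, x ∈ Ioo a b → HasDerivAt F (f x) x := by
  filter_upwards [h.intervalIntegrable.ae_hasDerivAt_integral] with x hx hxab
  have hab : a ≤ b := hxab.1.le.trans hxab.2.le
  have h1 := (hx (by rw [uIcc_of_le hab]; exact ⟨hxab.1.le, hxab.2.le⟩) a (by simp)).const_add (F a)
  refine h1.congr_of_eventuallyEq ?_
  filter_upwards [Icc_mem_nhds hxab.1 hxab.2] with y hy
  exact h.eq_add_integral y hy

lemma mul (hF : IsPrimitiveOn a b F f) (hG : IsPrimitiveOn a b G g) (hab : a ≤ b) :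
    IsPrimitiveOn a b (fun x => F x * G x) (fun x => f x * G x + F x * g x) where
  intervalIntegrable := by
    have h1 := hF.continuousOn hab
    have h2 := hG.continuousOn hab
    rw [← uIcc_of_le hab] at h1 h2
    exact (hF.intervalIntegrable.mul_continuousOn h2).add
      (hG.intervalIntegrable.continuousOn_mul h1)
  eq_add_integral x hx := by
    have ha : a ∈ Icc a b := ⟨le_rfl, hab⟩
    have hF' := hF.mono ha hx
    have hG' := hG.mono ha hx
    have key := ((hF'.absolutelyContinuous hx.1).fun_mul
      (hG'.absolutelyContinuous hx.1)).integral_deriv_eq_sub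
    have hcongr : ∫ t in a..x, deriv (fun s => F s * G s) t
        = ∫ t in a..x, (f t * G t + F t * g t) := by
      apply intervalIntegral.integral_congr_ae
      filter_upwards [hF'.ae_hasDerivAt, hG'.ae_hasDerivAt,
        (measure_eq_zero_iff_ae_notMem.mp (measure_singleton x) : ∀ᵐ t, t ∉ ({x} : Set ℝ))]
        with t h1 h2 h3 ht
      rw [uIoc_of_le hx.1] at ht
      have ht' : t ∈ Ioo a x := ⟨ht.1, lt_of_le_of_ne ht.2 h3⟩
      exact ((h1 ht').mul (h2 ht')).deriv
    rw [← hcongr, key]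
    ring

lemma congr (h : IsPrimitiveOn a b F f) (hab : a ≤ b)
    (hfg : ∀ᵐ x ∂volume.restrict (Ioo a b), f x = g x) : IsPrimitiveOn a b F g := by
  have hIoc : ∀ᵐ x ∂volume.restrict (Ioc a b), f x = g x := by
    rwa [← restrict_Ioo_eq_restrict_Ioc]
  refine ⟨h.intervalIntegrable.congr_ae (by rwa [uIoc_of_le hab]), fun x hx => ?_⟩
  rw [h.eq_add_integral x hx]
  congr 1
  apply intervalIntegral.integral_congr_ae
  rw [ae_restrict_iff' measurableSet_Ioc] at hIoc
  filter_upwards [hIoc] with t ht ht'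
  rw [uIoc_of_le hx.1] at ht'
  exact ht ⟨ht'.1, ht'.2.trans hx.2⟩

lemma of_hasDerivAt (hF : ∀ x, HasDerivAt F (f x) x) (hf : Continuous f) :
    IsPrimitiveOn a b F f where
  intervalIntegrable := hf.intervalIntegrable a b
  eq_add_integral x _ := by
    rw [intervalIntegral.integral_eq_sub_of_hasDerivAt (fun t _ => hF t)
      (hf.intervalIntegrable a x)]
    ring

lemma of_integrableOn (hf : IntegrableOn f (Ioo a b)) (hab : a ≤ b) (c : ℝ) :
    IsPrimitiveOn a b (fun x => c + ∫ t in a..x, f t) f where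
  intervalIntegrable := by
    rw [intervalIntegrable_iff_integrableOn_Ioo_of_le hab]
    exact hf
  eq_add_integral x _ := by simp

lemma integrableOn (h : IsPrimitiveOn a b F f) (hab : a ≤ b) : IntegrableOn f (Ioo a b) :=
  (intervalIntegrable_iff_integrableOn_Ioo_of_le hab).mp h.intervalIntegrable

lemma integral_Ioo_eq (h : IsPrimitiveOn a b F f) (hab : a ≤ b) :
    ∫ t in Ioo a b, f t = F b - F a := by
  rw [← h.integral_eq ⟨le_rfl, hab⟩ ⟨hab, le_rfl⟩, intervalIntegral.integral_of_le hab,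
    integral_Ioc_eq_integral_Ioo]

/-- Integration by parts. -/
lemma integral_mul_eq (hF : IsPrimitiveOn a b F f) (hG : IsPrimitiveOn a b G g) (hab : a ≤ b) :
    ∫ t in Ioo a b, F t * g t = F b * G b - F a * G a - ∫ t in Ioo a b, f t * G t := by
  have h := (hF.mul hG hab).integral_Ioo_eq hab
  have hFc := hF.continuousOn hab
  have hGc := hG.continuousOn hab
  have h1 : IntegrableOn (fun t => f t * G t) (Ioo a b) := by
    rw [← intervalIntegrable_iff_integrableOn_Ioo_of_le hab]
    exact hF.intervalIntegrable.mul_continuousOn (by rwa [uIcc_of_le hab])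
  have h2 : IntegrableOn (fun t => F t * g t) (Ioo a b) := by
    rw [← intervalIntegrable_iff_integrableOn_Ioo_of_le hab]
    exact hG.intervalIntegrable.continuousOn_mul (by rwa [uIcc_of_le hab])
  rw [integral_add h1 h2] at h
  linarith

end IsPrimitiveOn

/-! ### Absolutely continuous representatives of Sobolev functions -/

lemma tsupport_notMem_endpoints {L : ℝ} {φ : ℝ → ℝ} (hφ : tsupport φ ⊆ Ioo 0 L) :
    φ 0 = 0 ∧ φ L = 0 := by
  constructor <;>
  · by_contra h
    have := hφ (subset_tsupport _ h)
    simp at this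

/-- The almost everywhere derivative of an absolutely continuous function is its weak derivative. -/
lemma IsPrimitiveOn.isWeakDeriv {L : ℝ} (hL : 0 < L) {F f : ℝ → ℝ}
    (h : IsPrimitiveOn 0 L F f) : IsWeakDeriv L F f := by
  intro φ hφ _ hsupp
  have h2 : IsPrimitiveOn 0 L φ (deriv φ) :=
    .of_hasDerivAt (fun x => (hφ.differentiable (by simp) x).hasDerivAt)
      (hφ.continuous_deriv (by simp))
  rw [h.integral_mul_eq h2 hL.le]
  simp [tsupport_notMem_endpoints hsupp]

/-- The du Bois-Reymond lemma: a function whose weak derivative vanishes is constant. -/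
lemma ae_eq_const_of_isWeakDeriv_zero {L : ℝ} (hL : 0 < L) {v : ℝ → ℝ}
    (hv : IntegrableOn v (Ioo 0 L)) (h : IsWeakDeriv L v 0) :
    ∃ c, ∀ᵐ x ∂volume.restrict (Ioo 0 L), v x = c := by
  -- a reference bump of mass one turns every test function into a derivative plus a multiple of it
  obtain ⟨B, hBsupp⟩ : ∃ B : ContDiffBump (L / 2), B.rOut = L / 4 :=
    ⟨⟨L / 8, L / 4, by linarith, by linarith⟩, rfl⟩
  set ψ : ℝ → ℝ := B.normed volume
  have hψs : ContDiff ℝ ∞ ψ := B.contDiff_normed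
  have hψI : ∫ x, ψ x = 1 := B.integral_normed
  have hψt : tsupport ψ ⊆ Icc (L / 4) (3 * L / 4) := by
    rw [B.tsupport_normed_eq, hBsupp, Real.closedBall_eq_Icc]
    exact Icc_subset_Icc (by linarith) (by linarith)
  set c := ∫ x in Ioo 0 L, v x * ψ x
  refine ⟨c, ?_⟩
  have hloc : LocallyIntegrableOn (fun x => v x - c) (Ioo 0 L) :=
    (hv.sub (integrableOn_const (by simp))).locallyIntegrableOn
  have key := isOpen_Ioo.ae_eq_zero_of_integral_contDiff_smul_eq_zero hloc ?_
  · rw [ae_restrict_iff' measurableSet_Ioo]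
    filter_upwards [key] with x hx hxm
    linarith [hx hxm]
  intro η hη hηc hηs
  set m := ∫ x, η x
  set θ : ℝ → ℝ := fun x => η x - m * ψ x
  have hθs : ContDiff ℝ ∞ θ := hη.sub (contDiff_const.mul hψs)
  obtain ⟨α, β, hα, hβ, hβL, hαβ, hsub⟩ : ∃ α β : ℝ, 0 < α ∧ α ≤ β ∧ β < L ∧
      tsupport ψ ⊆ Icc α β ∧ tsupport η ⊆ Icc α β := by
    have hcomp : IsCompact (insert (L / 2) (tsupport η)) := hηc.isCompact.insert _
    have hmem : insert (L / 2) (tsupport η) ⊆ Ioo 0 L :=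
      insert_subset ⟨by linarith, by linarith⟩ hηs
    have hne : (insert (L / 2) (tsupport η)).Nonempty := insert_nonempty _ _
    have h1 := hmem (hcomp.sInf_mem hne)
    have h2 := hmem (hcomp.sSup_mem hne)
    have hle : ∀ x ∈ insert (L / 2) (tsupport η), sInf (insert (L / 2) (tsupport η)) ≤ x ∧
        x ≤ sSup (insert (L / 2) (tsupport η)) :=
      fun x hx => ⟨csInf_le hcomp.bddBelow hx, le_csSup hcomp.bddAbove hx⟩
    have h3 := hle (L / 2) (mem_insert _ _)
    refine ⟨min (L / 4) (sInf (insert (L / 2) (tsupport η))),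
      max (3 * L / 4) (sSup (insert (L / 2) (tsupport η))), lt_min (by linarith) h1.1, ?_,
      max_lt (by linarith) h2.2, ?_, ?_⟩
    · exact (min_le_left _ _).trans (le_trans (by linarith) (le_max_left _ _))
    · exact hψt.trans (Icc_subset_Icc (min_le_left _ _) (le_max_left _ _))
    · intro x hx
      have := hle x (mem_insert_of_mem _ hx)
      exact ⟨(min_le_right _ _).trans this.1, this.2.trans (le_max_right _ _)⟩
  have hθ0 : ∀ x, x ∉ Icc α β → θ x = 0 := by
    intro x hx
    have h1 : η x = 0 := image_eq_zero_of_notMem_tsupport fun h => hx (hsub h)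
    have h2 : ψ x = 0 := image_eq_zero_of_notMem_tsupport fun h => hx (hαβ h)
    simp [θ, h1, h2]
  have hψint : Integrable ψ := B.integrable_normed
  have hηint : Integrable η := hη.continuous.integrable_of_hasCompactSupport hηc
  have hθI : ∫ x, θ x = 0 := by
    simp only [θ]
    rw [integral_sub hηint (hψint.const_mul m), integral_const_mul, hψI]
    simp [m]
  set φ : ℝ → ℝ := fun x => ∫ t in (0:ℝ)..x, θ t
  have hφd : ∀ x, HasDerivAt φ (θ x) x := fun x =>
    intervalIntegral.integral_hasDerivAt_right (hθs.continuous.intervalIntegrable _ _)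
      hθs.continuous.stronglyMeasurable.stronglyMeasurableAtFilter hθs.continuous.continuousAt
  have hφderiv : deriv φ = θ := funext fun x => (hφd x).deriv
  have hφs : ContDiff ℝ ∞ φ := by
    rw [contDiff_infty_iff_deriv]
    exact ⟨fun x => (hφd x).differentiableAt, by rwa [hφderiv]⟩
  have hfull : ∀ x y, x ≤ α → β ≤ y → ∫ t in x..y, θ t = 0 := by
    intro x y hx hy
    rw [intervalIntegral.integral_of_le (by linarith), integral_Ioc_eq_integral_Ioo,
      ← integral_Icc_eq_integral_Ioo, setIntegral_eq_integral_of_forall_compl_eq_zero, hθI]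
    intro t ht
    exact hθ0 t fun h => ht ⟨hx.trans h.1, h.2.trans hy⟩
  have hφ0 : ∀ x, x ∉ Icc α β → φ x = 0 := by
    intro x hx
    by_cases hxα : x < α
    · have : ∀ t ∈ uIcc 0 x, θ t = 0 := fun t ht => hθ0 t fun h => by
        have : t < α := lt_of_le_of_lt ht.2 (max_lt hα hxα)
        exact absurd h.1 (not_le.mpr this)
      simp only [φ]
      rw [intervalIntegral.integral_congr (g := fun _ => 0) this]
      simp
    · have : β < x := by
        by_contra h
        exact hx ⟨not_lt.mp hxα, not_lt.mp h⟩
      exact hfull 0 x hα.le this.le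
  have hφt : tsupport φ ⊆ Icc α β :=
    closure_minimal (fun x hx => by_contra fun h => hx (hφ0 x h)) isClosed_Icc
  have hφc : HasCompactSupport φ := HasCompactSupport.intro isCompact_Icc hφ0
  have h0 := h φ hφs hφc (hφt.trans fun x hx => ⟨hα.trans_le hx.1, hx.2.trans_lt hβL⟩)
  rw [hφderiv] at h0
  simp only [Pi.zero_apply, zero_mul, integral_zero, neg_zero] at h0
  have bdd : ∀ g : ℝ → ℝ, Continuous g → IntegrableOn (fun x => v x * g x) (Ioo 0 L) := by
    intro g hg
    rw [← intervalIntegrable_iff_integrableOn_Ioo_of_le hL.le] at hv ⊢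
    exact hv.mul_continuousOn hg.continuousOn
  have hsplit : ∫ x in Ioo 0 L, v x * θ x = (∫ x in Ioo 0 L, v x * η x) - m * c := by
    simp only [θ, c]
    rw [← integral_const_mul, ← integral_sub (bdd _ hη.continuous)
      ((bdd _ hψs.continuous).const_mul m)]
    congr 1; ext x; ring
  have hm : ∫ x in Ioo 0 L, η x = m :=
    setIntegral_eq_integral_of_forall_compl_eq_zero fun x hx =>
      image_eq_zero_of_notMem_tsupport fun h => hx (hηs h)
  have hred : ∫ x, η x • (v x - c) = ∫ x in Ioo 0 L, (v x * η x - c * η x) := by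
    rw [← setIntegral_eq_integral_of_forall_compl_eq_zero (s := Ioo 0 L)]
    · congr 1; ext x; simp only [smul_eq_mul]; ring
    · intro x hx
      rw [image_eq_zero_of_notMem_tsupport fun h => hx (hηs h), zero_smul]
  rw [hred, integral_sub (bdd _ hη.continuous) (hηint.integrableOn.const_mul c),
    integral_const_mul, hm]
  rw [hsplit] at h0
  linarith

/-- Every Sobolev function agrees almost everywhere with a primitive of its weak derivative. -/
lemma exists_isPrimitiveOn_of_isWeakDeriv {L : ℝ} (hL : 0 < L) {v g : ℝ → ℝ}
    (hv : IntegrableOn v (Ioo 0 L)) (hg : IntegrableOn g (Ioo 0 L)) (h : IsWeakDeriv L v g) :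
    ∃ V, IsPrimitiveOn 0 L V g ∧ ∀ᵐ x ∂volume.restrict (Ioo 0 L), v x = V x := by
  have hP := IsPrimitiveOn.of_integrableOn hg hL.le 0
  have hPi : IntegrableOn (fun x => 0 + ∫ t in (0:ℝ)..x, g t) (Ioo 0 L) :=
    ((hP.continuousOn hL.le).integrableOn_compact isCompact_Icc).mono_set Ioo_subset_Icc_self
  obtain ⟨c, hc⟩ := ae_eq_const_of_isWeakDeriv_zero hL (hv.sub hPi) (by
    intro φ hφ hφc hφs
    have h1 := h φ hφ hφc hφs
    have h2 := hP.isWeakDeriv hL φ hφ hφc hφs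
    have bdd : ∀ w : ℝ → ℝ, IntegrableOn w (Ioo 0 L) →
        IntegrableOn (fun x => w x * deriv φ x) (Ioo 0 L) := by
      intro w hw
      rw [← intervalIntegrable_iff_integrableOn_Ioo_of_le hL.le] at hw ⊢
      exact hw.mul_continuousOn (hφ.continuous_deriv (by simp)).continuousOn
    simp only [Pi.sub_apply, sub_mul, Pi.zero_apply, zero_mul, integral_zero, neg_zero]
    rw [integral_sub (bdd _ hv) (bdd _ hPi), h1, h2, sub_self])
  refine ⟨fun x => c + ∫ t in (0:ℝ)..x, g t, .of_integrableOn hg hL.le c, ?_⟩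
  filter_upwards [hc] with x hx
  simp only [Pi.sub_apply] at hx
  linarith

/-! ### The Neumann problem as a first order system -/

/-- `(U, W)` solves the first order system `U' = W`, `W' = -a U` on `[0, L]` in the sense of
Carathéodory. -/
structure IsSystemSolution (L : ℝ) (a U W : ℝ → ℝ) : Prop where
  left : IsPrimitiveOn 0 L U W
  right : IsPrimitiveOn 0 L W (fun x => -(a x * U x))

lemma IsPrimitiveOn.memLp {L : ℝ} (hL : 0 ≤ L) {F f : ℝ → ℝ} (h : IsPrimitiveOn 0 L F f) :
    MemLp F 2 (volume.restrict (Ioo 0 L)) := by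
  obtain ⟨C, hC⟩ := isCompact_Icc.exists_bound_of_continuousOn (h.continuousOn hL)
  refine MemLp.of_bound (((h.continuousOn hL).mono Ioo_subset_Icc_self).aestronglyMeasurable
    measurableSet_Ioo) C ?_
  filter_upwards [ae_restrict_mem measurableSet_Ioo] with x hx
  exact hC x (Ioo_subset_Icc_self hx)

lemma IsPrimitiveOn.isSobolevWith {L : ℝ} (hL : 0 < L) {F f : ℝ → ℝ} (h : IsPrimitiveOn 0 L F f)
    (hf : MemLp f 2 (volume.restrict (Ioo 0 L))) : IsSobolevWith L F f :=
  ⟨h.memLp hL.le, hf, h.isWeakDeriv hL⟩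

lemma IsSobolevWith.exists_isPrimitiveOn {L : ℝ} (hL : 0 < L) {v v' : ℝ → ℝ}
    (h : IsSobolevWith L v v') :
    ∃ V, IsPrimitiveOn 0 L V v' ∧ ∀ᵐ x ∂volume.restrict (Ioo 0 L), v x = V x :=
  exists_isPrimitiveOn_of_isWeakDeriv hL (h.memLp.integrable (by norm_num))
    (h.memLp_deriv.integrable (by norm_num)) h.weakDeriv

/-- A solution of the system that satisfies the Neumann conditions is a weak solution. -/
lemma IsSystemSolution.isNeumannSolution {L : ℝ} (hL : 0 < L) {a U W : ℝ → ℝ}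
    (h : IsSystemSolution L a U W) (h0 : W 0 = 0) (h1 : W L = 0) : IsNeumannSolution L a U := by
  refine ⟨W, h.left.isSobolevWith hL (h.right.memLp hL.le), fun v v' hv => ?_⟩
  obtain ⟨V, hV, hvV⟩ := hv.exists_isPrimitiveOn hL
  rw [h.right.integral_mul_eq hV hL.le, h0, h1, zero_mul, zero_mul, sub_zero, zero_sub,
    ← integral_neg]
  refine integral_congr_ae ?_
  filter_upwards [hvV] with x hx
  rw [hx]; ring

/-- Regularity of weak solutions. Testing with all primitives `V` of square integrable functions
`g` shows that `u' - P`, where `P` is the primitive of `-a u` vanishing at `0`, is orthogonal to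
every `g`. -/
lemma IsNeumannSolution.exists_isSystemSolution {L : ℝ} (hL : 0 < L) {a u : ℝ → ℝ}
    (ha : IntegrableOn a (Ioo 0 L)) (h : IsNeumannSolution L a u) :
    ∃ U W, IsSystemSolution L a U W ∧ W 0 = 0 ∧ W L = 0 ∧
      ∀ᵐ x ∂volume.restrict (Ioo 0 L), u x = U x := by
  obtain ⟨u', hu, hw⟩ := h
  obtain ⟨U, hU, huU⟩ := hu.exists_isPrimitiveOn hL
  have haU : IntegrableOn (fun x => -(a x * U x)) (Ioo 0 L) := by
    rw [← intervalIntegrable_iff_integrableOn_Ioo_of_le hL.le] at ha ⊢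
    exact (ha.mul_continuousOn (by rw [uIcc_of_le hL.le]; exact hU.continuousOn hL.le)).neg
  have hP := IsPrimitiveOn.of_integrableOn haU hL.le 0
  set P : ℝ → ℝ := fun x => 0 + ∫ t in (0:ℝ)..x, -(a t * U t)
  have hP0 : P 0 = 0 := by simp [P]
  have hPm := hP.memLp hL.le
  have key : ∀ V g : ℝ → ℝ, IsPrimitiveOn 0 L V g → MemLp g 2 (volume.restrict (Ioo 0 L)) →
      ∫ x in Ioo 0 L, u' x * g x = (∫ x in Ioo 0 L, P x * g x) - P L * V L := by
    intro V g hV hg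
    rw [hw V g (hV.isSobolevWith hL hg), hP.integral_mul_eq hV hL.le, hP0, zero_mul, sub_zero]
    have : ∫ x in Ioo 0 L, a x * u x * V x = -∫ x in Ioo 0 L, -(a x * U x) * V x := by
      rw [← integral_neg]
      refine integral_congr_ae ?_
      filter_upwards [huU] with x hx
      rw [hx]; ring
    rw [this]; ring
  have hPL : P L = 0 := by
    have := key (fun _ => 1) (fun _ => 0)
      (.of_hasDerivAt (fun x => hasDerivAt_const x 1) continuous_const) (by simp)
    simpa using this
  have hgm : MemLp (fun x => u' x - P x) 2 (volume.restrict (Ioo 0 L)) := hu.memLp_deriv.sub hPm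
  -- the choice `g = u' - P` gives `∫ (u' - P)² = 0`
  have hsq := key _ _ (.of_integrableOn (hgm.integrable (by norm_num)) hL.le 0) hgm
  rw [hPL, zero_mul, sub_zero] at hsq
  have i1 := hu.memLp_deriv.integrable_mul hgm
  have i2 := hPm.integrable_mul hgm
  have hz : ∫ x in Ioo 0 L, (u' x - P x) ^ 2 = 0 := by
    have e := integral_sub i1 i2
    simp only [Pi.mul_apply] at e
    rw [hsq, sub_self] at e
    refine (integral_congr_ae (.of_forall fun x => ?_)).trans e
    ring
  rw [integral_eq_zero_iff_of_nonneg (fun x => sq_nonneg _) hgm.integrable_sq] at hz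
  refine ⟨U, P, ⟨hU.congr hL.le ?_, hP⟩, hP0, hPL, huU⟩
  filter_upwards [hz] with x hx
  have : u' x - P x = 0 := by simpa using hx
  linarith

/-! ### Uniqueness, disfocality and Sturm comparison -/

namespace IsSystemSolution

variable {L : ℝ} {a U W : ℝ → ℝ}

lemma neg (h : IsSystemSolution L a U W) :
    IsSystemSolution L a (fun x => -U x) (fun x => -W x) where
  left := ⟨h.left.intervalIntegrable.neg, fun x hx => by
    rw [h.left.eq_add_integral x hx, intervalIntegral.integral_neg]; ring⟩
  right := ⟨by
      have := h.right.intervalIntegrable.neg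
      refine this.congr fun x _ => ?_
      simp, fun x hx => by
    rw [h.right.eq_add_integral x hx, ← sub_eq_zero]
    simp only [mul_neg, neg_neg, intervalIntegral.integral_neg]
    ring⟩

lemma hasDerivAt (h : IsSystemSolution L a U W) {x : ℝ} (hx : x ∈ Ioo 0 L) :
    HasDerivAt U (W x) x := by
  have hL : 0 ≤ L := hx.1.le.trans hx.2.le
  have hc := h.right.continuousOn hL
  have hn : Icc 0 L ∈ nhds x := Icc_mem_nhds hx.1 hx.2
  have h1 : HasDerivAt (fun y => ∫ t in (0:ℝ)..y, W t) (W x) x :=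
    intervalIntegral.integral_hasDerivAt_right
      (h.left.intervalIntegrable_sub ⟨le_rfl, hL⟩ ⟨hx.1.le, hx.2.le⟩)
      ⟨Icc 0 L, hn, hc.aestronglyMeasurable measurableSet_Icc⟩ (hc.continuousAt hn)
  refine (h1.const_add (U 0)).congr_of_eventuallyEq ?_
  filter_upwards [hn] with y hy
  exact h.left.eq_add_integral y hy

/-- The Wronskian identity against a solution `s` of `s'' + ν² s = 0`. -/
lemma isPrimitiveOn_wronskian (h : IsSystemSolution L a U W) (hL : 0 ≤ L) {ν : ℝ} {s s' : ℝ → ℝ}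
    (hs : ∀ t, HasDerivAt s (s' t) t) (hs' : ∀ t, HasDerivAt s' (-(ν ^ 2 * s t)) t) :
    IsPrimitiveOn 0 L (fun t => U t * s' t - W t * s t)
      (fun t => (a t - ν ^ 2) * (U t * s t)) := by
  have cs : Continuous s := continuous_iff_continuousAt.mpr fun t => (hs t).continuousAt
  have cs' : Continuous s' := continuous_iff_continuousAt.mpr fun t => (hs' t).continuousAt
  have p1 := h.left.mul (IsPrimitiveOn.of_hasDerivAt (a := 0) (b := L) hs' (by fun_prop)) hL
  have p2 := h.right.mul (IsPrimitiveOn.of_hasDerivAt (a := 0) (b := L) hs cs') hL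
  have hfun : (fun t => (a t - ν ^ 2) * (U t * s t)) =
      fun t => (W t * s' t + U t * -(ν ^ 2 * s t)) - (-(a t * U t) * s t + W t * s' t) := by
    ext t; ring
  rw [hfun]
  refine ⟨p1.intervalIntegrable.sub p2.intervalIntegrable, fun x hx => ?_⟩
  have h0 : (0:ℝ) ∈ Icc 0 L := ⟨le_rfl, hL⟩
  rw [intervalIntegral.integral_sub (p1.intervalIntegrable_sub h0 hx)
    (p2.intervalIntegrable_sub h0 hx), p1.integral_eq h0 hx, p2.integral_eq h0 hx]
  ring

/-- Trivial Cauchy data give zero on a neighbourhood whose size depends only on `a`: the maximum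
`M` of `|U|` between `z` and `x` satisfies `M ≤ M / 2`. -/
lemma eq_zero_near (h : IsSystemSolution L a U W) (ha : IntegrableOn a (Ioo 0 L))
    {z x : ℝ} (hz : z ∈ Icc 0 L) (hx : x ∈ Icc 0 L) (hU : U z = 0) (hW : W z = 0)
    (hxz : |x - z| * ((∫ t in Ioo 0 L, |a t|) + 1) ≤ 1 / 2) : U x = 0 ∧ W x = 0 := by
  have hL : 0 ≤ L := hz.1.trans hz.2
  set A := ∫ t in Ioo 0 L, |a t| with hA
  have hA0 : 0 ≤ A := integral_nonneg fun _ => abs_nonneg _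
  have hJ : uIcc z x ⊆ Icc 0 L := uIcc_subset_Icc hz hx
  obtain ⟨q, hq, hmax⟩ := isCompact_uIcc.exists_isMaxOn (nonempty_uIcc (a := z) (b := x))
    ((h.left.continuousOn hL).mono hJ).abs
  have hmax' : ∀ t ∈ uIcc z x, |U t| ≤ |U q| := fun t ht => hmax ht
  have hWb : ∀ t ∈ uIcc z x, |W t| ≤ |U q| * A := by
    intro t ht
    have e := h.right.integral_eq hz (hJ ht)
    rw [hW, sub_zero] at e
    rw [← e, ← Real.norm_eq_abs]
    have hsub : uIoc z t ⊆ Ioc 0 L := by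
      intro r hr
      exact ⟨lt_of_le_of_lt (le_min hz.1 (hJ ht).1) hr.1,
        hr.2.trans (max_le hz.2 (hJ ht).2)⟩
    have ha' : IntegrableOn (fun t => |a t|) (Ioc 0 L) := by
      rw [integrableOn_Ioc_iff_integrableOn_Ioo]; exact ha.abs
    calc ‖∫ r in z..t, -(a r * U r)‖ ≤ ∫ r in uIoc z t, ‖-(a r * U r)‖ :=
          intervalIntegral.norm_integral_le_integral_norm_uIoc
      _ ≤ ∫ r in uIoc z t, |U q| * |a r| := by
          refine setIntegral_mono_on ?_ ((ha'.mono_set hsub).const_mul _) measurableSet_uIoc ?_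
          · exact (h.right.intervalIntegrable_sub hz (hJ ht)).def'.norm
          · intro r hr
            rw [norm_neg, norm_mul, Real.norm_eq_abs, Real.norm_eq_abs, mul_comm]
            exact mul_le_mul_of_nonneg_right
              (hmax' r (uIcc_subset_uIcc_left ht (uIoc_subset_uIcc hr))) (abs_nonneg _)
      _ = |U q| * ∫ r in uIoc z t, |a r| := integral_const_mul _ _
      _ ≤ |U q| * A := by
          refine mul_le_mul_of_nonneg_left ?_ (abs_nonneg _)
          rw [hA, ← integral_Ioc_eq_integral_Ioo]
          exact setIntegral_mono_set ha' (Filter.Eventually.of_forall fun _ => abs_nonneg _)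
            (Filter.Eventually.of_forall hsub)
  have hUq : |U q| ≤ |U q| * A * |q - z| := by
    have e := h.left.integral_eq hz (hJ hq)
    rw [hU, sub_zero] at e
    conv_lhs => rw [← e, ← Real.norm_eq_abs]
    exact intervalIntegral.norm_integral_le_of_norm_le_const fun r hr =>
      hWb r (uIcc_subset_uIcc_left hq (uIoc_subset_uIcc hr))
  have hqx : |q - z| ≤ |x - z| := abs_sub_left_of_mem_uIcc hq
  have hUq0 : |U q| = 0 := by
    have h1 : A * |q - z| ≤ 1 / 2 := by nlinarith [abs_nonneg (q - z), abs_nonneg (x - z)]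
    nlinarith [abs_nonneg (U q)]
  constructor
  · have := hmax' x right_mem_uIcc
    rw [hUq0] at this
    exact abs_nonpos_iff.mp this
  · have := hWb x right_mem_uIcc
    rw [hUq0, zero_mul] at this
    exact abs_nonpos_iff.mp this

/-- Trivial Cauchy data at one point force the zero solution. -/
lemma eq_zero_of_cauchy (h : IsSystemSolution L a U W) (ha : IntegrableOn a (Ioo 0 L))
    {z : ℝ} (hz : z ∈ Icc 0 L) (hU : U z = 0) (hW : W z = 0) :
    ∀ x ∈ Icc 0 L, U x = 0 := by
  set A := ∫ t in Ioo 0 L, |a t| with hA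
  have hA0 : 0 ≤ A := integral_nonneg fun _ => abs_nonneg _
  -- cross from `z` to `x` in `k` equal steps, each short enough for `eq_zero_near`
  intro x hx
  obtain ⟨k, hk⟩ := exists_nat_ge (2 * |x - z| * (A + 1))
  have hk0 : (0:ℝ) < k + 1 := by positivity
  have hmem : ∀ j : ℕ, j ≤ k + 1 → z + j / (k + 1 : ℝ) * (x - z) ∈ Icc 0 L := by
    intro j hj
    have h1 : (j:ℝ) / (k + 1) ≤ 1 := by
      rw [div_le_one hk0]; exact_mod_cast hj
    have h2 : (0:ℝ) ≤ j / (k + 1) := by positivity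
    have : z + j / (k + 1 : ℝ) * (x - z) = (1 - j / (k + 1 : ℝ)) • z + (j / (k + 1 : ℝ)) • x := by
      simp only [smul_eq_mul]; ring
    rw [this]
    exact convex_Icc 0 L hz hx (by linarith) h2 (by ring)
  have step : ∀ j : ℕ, j ≤ k + 1 → U (z + j / (k + 1 : ℝ) * (x - z)) = 0 ∧
      W (z + j / (k + 1 : ℝ) * (x - z)) = 0 := by
    intro j
    induction j with
    | zero => intro _; simp [hU, hW]
    | succ j ih =>
      intro hj
      obtain ⟨i1, i2⟩ := ih (by omega)
      refine h.eq_zero_near ha (hmem j (by omega)) (hmem (j + 1) hj) i1 i2 ?_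
      have : z + ((j + 1 : ℕ) : ℝ) / (k + 1 : ℝ) * (x - z) - (z + j / (k + 1 : ℝ) * (x - z))
          = (x - z) / (k + 1) := by
        push_cast; field_simp; ring
      rw [this, abs_div, abs_of_pos hk0, div_mul_eq_mul_div, div_le_iff₀ hk0]
      linarith
  have := (step (k + 1) le_rfl).1
  rwa [show z + ((k + 1 : ℕ) : ℝ) / (k + 1 : ℝ) * (x - z) = x by
    push_cast; field_simp; ring] at this

lemma hasDerivAt_sin_comp (ν p t : ℝ) :
    HasDerivAt (fun t => Real.sin (ν * (t - p))) (ν * Real.cos (ν * (t - p))) t := by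
  have : HasDerivAt (fun t => ν * (t - p)) ν t := by
    simpa using ((hasDerivAt_id t).sub_const p).const_mul ν
  exact this.sin.congr_deriv (by ring)

lemma hasDerivAt_mul_cos_comp (ν p t : ℝ) :
    HasDerivAt (fun t => ν * Real.cos (ν * (t - p))) (-(ν ^ 2 * Real.sin (ν * (t - p)))) t := by
  have : HasDerivAt (fun t => ν * (t - p)) ν t := by
    simpa using ((hasDerivAt_id t).sub_const p).const_mul ν
  exact (this.cos.const_mul ν).congr_deriv (by ring)

/-- Disfocality. On an interval where `a - ν²` has `L¹` norm less than `ν cot (ν d)`, with `d` the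
length of the interval, a nontrivial solution cannot have both a zero and a critical point. -/
lemma eq_zero_of_disfocal (h : IsSystemSolution L a U W) (ha : IntegrableOn a (Ioo 0 L))
    {ν c e p q : ℝ} (hν : 0 < ν) (hc : c ∈ Icc 0 L) (he : e ∈ Icc 0 L)
    (hd : ν * (e - c) < Real.pi / 2)
    (hm : normL1 c e (fun x => a x - ν ^ 2) < ν * Real.cot (ν * (e - c)))
    (hp : p ∈ Icc c e) (hq : q ∈ Icc c e) (hUp : U p = 0) (hWq : W q = 0) :
    ∀ x ∈ Icc 0 L, U x = 0 := by
  have hL : 0 ≤ L := hc.1.trans hc.2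
  have hsub : Icc c e ⊆ Icc 0 L := Icc_subset_Icc hc.1 he.2
  have hJ : uIcc p q ⊆ Icc c e := uIcc_subset_Icc hp hq
  -- replacing `q` by a maximum point `r` of `|U|` between `p` and `q` bounds `U` on that interval
  obtain ⟨r, hr, hmax⟩ := isCompact_uIcc.exists_isMaxOn (nonempty_uIcc (a := p) (b := q))
    ((h.left.continuousOn hL).mono (hJ.trans hsub)).abs
  have hmax' : ∀ t ∈ uIcc p q, |U t| ≤ |U r| := fun t ht => hmax ht
  by_cases hUr : U r = 0
  · have hUq := hmax' q right_mem_uIcc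
    rw [hUr, abs_zero] at hUq
    exact h.eq_zero_of_cauchy ha (hsub hq) (abs_nonpos_iff.mp hUq) hWq
  exfalso
  have hrp : r ≠ p := fun e => hUr (e ▸ hUp)
  have hWr : W r = 0 := by
    by_cases hrq : r = q
    · rw [hrq, hWq]
    have hrI : r ∈ Ioo (min p q) (max p q) := by
      refine ⟨lt_of_le_of_ne hr.1 ?_, lt_of_le_of_ne hr.2 ?_⟩
      · rcases min_choice p q with h' | h' <;> rw [h'] <;> exact Ne.symm ‹_›
      · rcases max_choice p q with h' | h' <;> rw [h'] <;> assumption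
    have hr0 : r ∈ Ioo 0 L :=
      ⟨lt_of_le_of_lt (le_min (hsub hp).1 (hsub hq).1) hrI.1,
        lt_of_lt_of_le hrI.2 (max_le (hsub hp).2 (hsub hq).2)⟩
    have hloc : IsLocalMax (fun t => U t ^ 2) r := by
      filter_upwards [Ioo_mem_nhds hrI.1 hrI.2] with t ht
      exact sq_le_sq.mpr (hmax' t ⟨ht.1.le, ht.2.le⟩)
    have := hloc.hasDerivAt_eq_zero ((h.hasDerivAt hr0).pow 2)
    simpa [hUr] using this
  have hrc : r ∈ Icc c e := hJ hr
  -- the Wronskian with `sin (ν (t - p))` vanishes at `p` and is `ν U r cos (ν (r - p))` at `r`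
  have hw := (h.isPrimitiveOn_wronskian hL (hasDerivAt_sin_comp ν p)
    (hasDerivAt_mul_cos_comp ν p)).integral_eq (hsub hp) (hsub hrc)
  simp only [hUp, hWr, sub_self, mul_zero, Real.sin_zero, zero_mul, sub_zero] at hw
  set Θ := ν * (e - c)
  set θ := ν * |r - p|
  have hrp0 : 0 < |r - p| := abs_pos.mpr (sub_ne_zero.mpr hrp)
  have hrp1 : |r - p| ≤ e - c := by
    rw [abs_le]; constructor <;> linarith [hrc.1, hrc.2, hp.1, hp.2]
  have hθ0 : 0 < θ := mul_pos hν hrp0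
  have hθΘ : θ ≤ Θ := mul_le_mul_of_nonneg_left hrp1 hν.le
  have hsinθ : 0 < Real.sin θ := Real.sin_pos_of_pos_of_lt_pi hθ0 (by linarith [Real.pi_pos])
  have hsinΘ : 0 < Real.sin Θ :=
    Real.sin_pos_of_pos_of_lt_pi (by linarith) (by linarith [Real.pi_pos])
  have hcosθ : Real.cos (ν * (r - p)) = Real.cos θ := by
    rw [← Real.cos_abs, abs_mul, abs_of_pos hν]
  have ha' : IntegrableOn (fun t => |a t - ν ^ 2|) (Ioc c e) := by
    rw [integrableOn_Ioc_iff_integrableOn_Ioo]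
    have h2 : IntegrableOn (fun t => |a t - ν ^ 2|) (Ioo 0 L) :=
      (ha.sub (integrableOn_const (by simp))).abs
    exact h2.mono_set (Ioo_subset_Ioo hc.1 he.2)
  have hsubI : uIoc p r ⊆ Ioc c e := by
    intro t ht
    exact ⟨lt_of_le_of_lt (le_min hp.1 hrc.1) ht.1, ht.2.trans (max_le hp.2 hrc.2)⟩
  have hbound : |U r| * (ν * Real.cos θ) ≤
      |U r| * Real.sin θ * normL1 c e (fun x => a x - ν ^ 2) := by
    have hcosθ0 : 0 ≤ Real.cos θ :=
      Real.cos_nonneg_of_mem_Icc ⟨by linarith [Real.pi_pos], by linarith⟩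
    have e1 : |U r| * (ν * Real.cos θ) = ‖U r * (ν * Real.cos (ν * (r - p)))‖ := by
      rw [hcosθ, norm_mul, Real.norm_eq_abs, Real.norm_eq_abs,
        abs_of_nonneg (mul_nonneg hν.le hcosθ0)]
    rw [e1, ← hw]
    refine intervalIntegral.norm_integral_le_integral_norm_uIoc.trans ?_
    calc ∫ t in uIoc p r, ‖(a t - ν ^ 2) * (U t * Real.sin (ν * (t - p)))‖
        ≤ ∫ t in uIoc p r, |U r| * Real.sin θ * |a t - ν ^ 2| := by
          refine setIntegral_mono_on ?_ ((ha'.mono_set hsubI).const_mul _) measurableSet_uIoc ?_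
          · exact ((h.isPrimitiveOn_wronskian hL (hasDerivAt_sin_comp ν p)
              (hasDerivAt_mul_cos_comp ν p)).intervalIntegrable_sub (hsub hp)
              (hsub hrc)).def'.norm
          · intro t ht
            have ht' := uIoc_subset_uIcc ht
            rw [norm_mul, norm_mul, Real.norm_eq_abs, Real.norm_eq_abs, Real.norm_eq_abs,
              mul_comm]
            refine mul_le_mul_of_nonneg_right ?_ (abs_nonneg _)
            refine mul_le_mul (hmax' t (uIcc_subset_uIcc_left hr ht')) ?_ (abs_nonneg _)
              (abs_nonneg _)
            have h1 : |t - p| ≤ |r - p| := abs_sub_left_of_mem_uIcc ht'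
            have h2 : ν * |t - p| ≤ θ := mul_le_mul_of_nonneg_left h1 hν.le
            have h3 : |Real.sin (ν * (t - p))| = Real.sin (ν * |t - p|) := by
              rcases abs_cases (t - p) with ⟨h4, _⟩ | ⟨h4, _⟩
              · rw [h4, abs_of_nonneg]
                refine Real.sin_nonneg_of_nonneg_of_le_pi (by positivity) ?_
                rw [h4] at h2; linarith [Real.pi_pos]
              · rw [h4, mul_neg, Real.sin_neg, abs_of_nonpos]
                rw [← neg_nonneg, ← Real.sin_neg, ← mul_neg, ← h4]
                exact Real.sin_nonneg_of_nonneg_of_le_pi (by positivity)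
                  (by linarith [Real.pi_pos])
            rw [h3]
            exact Real.sin_le_sin_of_le_of_le_pi_div_two
              (by linarith [Real.pi_pos, mul_nonneg hν.le (abs_nonneg (t - p))]) (by linarith) h2
      _ = |U r| * Real.sin θ * ∫ t in uIoc p r, |a t - ν ^ 2| := integral_const_mul _ _
      _ ≤ |U r| * Real.sin θ * normL1 c e (fun x => a x - ν ^ 2) := by
          refine mul_le_mul_of_nonneg_left ?_ (by positivity)
          rw [normL1, ← integral_Ioc_eq_integral_Ioo]
          exact setIntegral_mono_set ha' (Filter.Eventually.of_forall fun _ => abs_nonneg _)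
            (Filter.Eventually.of_forall hsubI)
  have hUr0 : 0 < |U r| := abs_pos.mpr hUr
  have h1 : ν * Real.cos θ ≤ Real.sin θ * normL1 c e (fun x => a x - ν ^ 2) := by
    rw [mul_assoc] at hbound
    exact le_of_mul_le_mul_left hbound hUr0
  have h2 : ν * Real.cos θ < Real.sin θ * (ν * Real.cot Θ) :=
    h1.trans_lt (mul_lt_mul_of_pos_left hm hsinθ)
  have h3 : 0 ≤ Real.sin (Θ - θ) :=
    Real.sin_nonneg_of_nonneg_of_le_pi (by linarith) (by linarith [Real.pi_pos])
  rw [Real.sin_sub] at h3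
  rw [Real.cot_eq_cos_div_sin] at h2
  have h4 : Real.sin θ * (ν * (Real.cos Θ / Real.sin Θ)) =
      ν * (Real.cos Θ * Real.sin θ) / Real.sin Θ := by ring
  rw [h4, lt_div_iff₀ hsinΘ] at h2
  nlinarith

/-- If `a ≥ ν²`, `U` and `s` are positive on `(x, y)`, and the Wronskian does not increase between
`x` and `y`, then it is unchanged and `a = ν²` on `(x, y)`. -/
lemma wronskian_rigidity (h : IsSystemSolution L a U W) {ν : ℝ} {s s' : ℝ → ℝ}
    (hs : ∀ t, HasDerivAt s (s' t) t) (hs' : ∀ t, HasDerivAt s' (-(ν ^ 2 * s t)) t)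
    {x y : ℝ} (hx : x ∈ Icc 0 L) (hy : y ∈ Icc 0 L) (hxy : x ≤ y)
    (hage : ∀ᵐ t ∂volume.restrict (Ioo 0 L), ν ^ 2 ≤ a t)
    (hU : ∀ t ∈ Ioo x y, 0 < U t) (hspos : ∀ t ∈ Ioo x y, 0 < s t)
    (hle : (U y * s' y - W y * s y) ≤ (U x * s' x - W x * s x)) :
    (U y * s' y - W y * s y) = (U x * s' x - W x * s x) ∧
      ∀ᵐ t ∂volume.restrict (Ioo x y), a t = ν ^ 2 := by
  have hp := (h.isPrimitiveOn_wronskian (hx.1.trans hx.2) hs hs').mono hx hy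
  have e := hp.integral_Ioo_eq hxy
  have hage' : ∀ᵐ t ∂volume.restrict (Ioo x y), ν ^ 2 ≤ a t :=
    ae_restrict_of_ae_restrict_of_subset (Ioo_subset_Ioo hx.1 hy.2) hage
  have hnn : 0 ≤ᵐ[volume.restrict (Ioo x y)] fun t => (a t - ν ^ 2) * (U t * s t) := by
    filter_upwards [hage', ae_restrict_mem measurableSet_Ioo] with t h1 h2
    exact mul_nonneg (by linarith) (mul_pos (hU t h2) (hspos t h2)).le
  have h0 := integral_nonneg_of_ae hnn
  have hz : ∫ t in Ioo x y, (a t - ν ^ 2) * (U t * s t) = 0 := le_antisymm (by linarith) h0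
  refine ⟨by linarith, ?_⟩
  rw [integral_eq_zero_iff_of_nonneg_ae hnn (hp.integrableOn hxy)] at hz
  filter_upwards [hz, ae_restrict_mem measurableSet_Ioo] with t h1 h2
  have h3 := (mul_pos (hU t h2) (hspos t h2)).ne'
  have : (a t - ν ^ 2) * (U t * s t) = 0 := h1
  have := (mul_eq_zero.mp this).resolve_right h3
  linarith

end IsSystemSolution

/-- A continuous function without zeros on `[x, y)` that is positive at `x` stays positive. -/
lemma pos_on_Ico {f : ℝ → ℝ} {x y : ℝ} (hf : ContinuousOn f (Icc x y)) (hx : 0 < f x)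
    (hne : ∀ t ∈ Ioo x y, f t ≠ 0) : ∀ t ∈ Ico x y, 0 < f t := by
  intro t ht
  by_contra hcon
  obtain ⟨r, hr, hr0⟩ := intermediate_value_Icc' ht.1
    (hf.mono (Icc_subset_Icc le_rfl ht.2.le)) ⟨not_lt.mp hcon, hx.le⟩
  have hrx : r ≠ x := fun e => by rw [e] at hr0; exact hx.ne' hr0
  exact hne r ⟨lt_of_le_of_ne hr.1 (Ne.symm hrx), hr.2.trans_lt ht.2⟩ hr0

lemma nonneg_right_of_pos_on_Ico {f : ℝ → ℝ} {x y : ℝ} (hxy : x < y)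
    (hf : ContinuousOn f (Icc x y)) (h : ∀ t ∈ Ico x y, 0 < f t) : 0 ≤ f y := by
  have : closure (Ico x y) = Icc x y := closure_Ico hxy.ne
  have hmem : y ∈ closure (Ico x y) := this ▸ ⟨hxy.le, le_rfl⟩
  have := ContinuousWithinAt.closure_le (f := fun _ => (0:ℝ)) hmem continuousWithinAt_const
    ((hf y ⟨hxy.le, le_rfl⟩).mono Ico_subset_Icc_self) (fun t ht => (h t ht).le)
  exact this

namespace IsSystemSolution

variable {L : ℝ} {a U W : ℝ → ℝ}

lemma exists_zero_after_critical_of_pos (h : IsSystemSolution L a U W) {ν ℓ z : ℝ} (hν : 0 < ν)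
    (hℓ : ν * ℓ = Real.pi / 2) (hz : 0 ≤ z) (hzL : z + ℓ ≤ L)
    (hage : ∀ᵐ t ∂volume.restrict (Ioo 0 L), ν ^ 2 ≤ a t) (hU : 0 < U z) (hW : W z = 0) :
    ∃ z', z < z' ∧ z' ≤ z + ℓ ∧ U z' = 0 ∧
      (z' = z + ℓ → ∀ᵐ t ∂volume.restrict (Ioo z z'), a t = ν ^ 2) := by
  have hℓ0 : 0 < ℓ := pos_of_mul_pos_right (hℓ ▸ by positivity) hν.le
  by_cases hex : ∃ z' ∈ Ioo z (z + ℓ), U z' = 0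
  · obtain ⟨z', hz', hU'⟩ := hex
    exact ⟨z', hz'.1, hz'.2.le, hU', fun e => absurd e hz'.2.ne⟩
  push Not at hex
  have hzm : z ∈ Icc 0 L := ⟨hz, by linarith⟩
  have hzm' : z + ℓ ∈ Icc 0 L := ⟨by linarith, hzL⟩
  have hcont := (h.left.continuousOn (hz.trans hzm.2)).mono (Icc_subset_Icc hz hzL)
  have hpos := pos_on_Ico hcont hU hex
  have hend := nonneg_right_of_pos_on_Ico (by linarith) hcont hpos
  -- compare with `cos (ν (t - z)) = sin (ν (t - (z - ℓ)))`
  obtain ⟨he, hae⟩ := h.wronskian_rigidity (hasDerivAt_sin_comp ν (z - ℓ))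
    (hasDerivAt_mul_cos_comp ν (z - ℓ)) hzm hzm' (by linarith) hage
    (fun t ht => hpos t ⟨ht.1.le, ht.2⟩)
    (fun t ht => Real.sin_pos_of_pos_of_lt_pi (mul_pos hν (by linarith [ht.1]))
      (by nlinarith [ht.2, mul_lt_mul_of_pos_left ht.2 hν]))
    (by
      rw [show ν * (z - (z - ℓ)) = Real.pi / 2 by rw [← hℓ]; ring,
        show ν * (z + ℓ - (z - ℓ)) = Real.pi by nlinarith [hℓ]]
      simp only [Real.cos_pi, Real.sin_pi, Real.cos_pi_div_two, hW]
      nlinarith)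
  refine ⟨z + ℓ, by linarith, le_rfl, ?_, fun _ => hae⟩
  rw [show ν * (z - (z - ℓ)) = Real.pi / 2 by rw [← hℓ]; ring,
    show ν * (z + ℓ - (z - ℓ)) = Real.pi by nlinarith [hℓ]] at he
  simp only [Real.cos_pi, Real.sin_pi, Real.cos_pi_div_two, hW] at he
  have : U (z + ℓ) * ν = 0 := by linarith
  exact (mul_eq_zero.mp this).resolve_right hν.ne'

lemma exists_critical_after_zero_of_pos (h : IsSystemSolution L a U W) {ν ℓ z : ℝ} (hν : 0 < ν)
    (hℓ : ν * ℓ = Real.pi / 2) (hz : 0 ≤ z) (hzL : z + ℓ ≤ L)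
    (hage : ∀ᵐ t ∂volume.restrict (Ioo 0 L), ν ^ 2 ≤ a t) (hU : U z = 0) (hW : 0 < W z) :
    ∃ z', z < z' ∧ z' ≤ z + ℓ ∧ W z' = 0 ∧
      (z' = z + ℓ → ∀ᵐ t ∂volume.restrict (Ioo z z'), a t = ν ^ 2) := by
  have hℓ0 : 0 < ℓ := pos_of_mul_pos_right (hℓ ▸ by positivity) hν.le
  by_cases hex : ∃ z' ∈ Ioo z (z + ℓ), W z' = 0
  · obtain ⟨z', hz', hW'⟩ := hex
    exact ⟨z', hz'.1, hz'.2.le, hW', fun e => absurd e hz'.2.ne⟩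
  push Not at hex
  have hzm : z ∈ Icc 0 L := ⟨hz, by linarith⟩
  have hzm' : z + ℓ ∈ Icc 0 L := ⟨by linarith, hzL⟩
  have hcont := (h.right.continuousOn (hz.trans hzm.2)).mono (Icc_subset_Icc hz hzL)
  have hpos := pos_on_Ico hcont hW hex
  have hend := nonneg_right_of_pos_on_Ico (by linarith) hcont hpos
  have hUpos : ∀ t ∈ Ioo z (z + ℓ), 0 < U t := by
    intro t ht
    have e := h.left.integral_eq hzm ⟨hz.trans ht.1.le, ht.2.le.trans hzL⟩
    rw [hU, sub_zero] at e
    rw [← e]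
    refine intervalIntegral.intervalIntegral_pos_of_pos_on
      (h.left.intervalIntegrable_sub hzm ⟨hz.trans ht.1.le, ht.2.le.trans hzL⟩)
      (fun r hr => hpos r ⟨hr.1.le, hr.2.trans ht.2⟩) ht.1
  obtain ⟨he, hae⟩ := h.wronskian_rigidity (hasDerivAt_sin_comp ν z)
    (hasDerivAt_mul_cos_comp ν z) hzm hzm' (by linarith) hage hUpos
    (fun t ht => Real.sin_pos_of_pos_of_lt_pi (mul_pos hν (by linarith [ht.1]))
      (by nlinarith [ht.2, mul_lt_mul_of_pos_left ht.2 hν, Real.pi_pos]))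
    (by
      rw [show ν * (z + ℓ - z) = Real.pi / 2 by rw [← hℓ]; ring, sub_self, mul_zero]
      simp only [Real.sin_pi_div_two, Real.cos_pi_div_two, Real.sin_zero, hU]
      nlinarith)
  refine ⟨z + ℓ, by linarith, le_rfl, ?_, fun _ => hae⟩
  rw [show ν * (z + ℓ - z) = Real.pi / 2 by rw [← hℓ]; ring, sub_self, mul_zero] at he
  simp only [Real.sin_pi_div_two, Real.cos_pi_div_two, Real.sin_zero, hU] at he
  linarith

/-- Sturm comparison: if `a ≥ ν²`, a critical point is followed by a zero at distance at most
`ℓ = π / (2ν)`, and the distance is `ℓ` only if `a = ν²` in between. -/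
lemma exists_zero_after_critical (h : IsSystemSolution L a U W) {ν ℓ z : ℝ} (hν : 0 < ν)
    (hℓ : ν * ℓ = Real.pi / 2) (hz : 0 ≤ z) (hzL : z + ℓ ≤ L)
    (hage : ∀ᵐ t ∂volume.restrict (Ioo 0 L), ν ^ 2 ≤ a t) (hU : U z ≠ 0) (hW : W z = 0) :
    ∃ z', z < z' ∧ z' ≤ z + ℓ ∧ U z' = 0 ∧
      (z' = z + ℓ → ∀ᵐ t ∂volume.restrict (Ioo z z'), a t = ν ^ 2) := by
  rcases hU.lt_or_gt with h1 | h1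
  · simpa using h.neg.exists_zero_after_critical_of_pos hν hℓ hz hzL hage (by linarith)
      (by linarith)
  · exact h.exists_zero_after_critical_of_pos hν hℓ hz hzL hage h1 hW

/-- Sturm comparison: if `a ≥ ν²`, a zero is followed by a critical point at distance at most
`ℓ = π / (2ν)`, and the distance is `ℓ` only if `a = ν²` in between. -/
lemma exists_critical_after_zero (h : IsSystemSolution L a U W) {ν ℓ z : ℝ} (hν : 0 < ν)
    (hℓ : ν * ℓ = Real.pi / 2) (hz : 0 ≤ z) (hzL : z + ℓ ≤ L)
    (hage : ∀ᵐ t ∂volume.restrict (Ioo 0 L), ν ^ 2 ≤ a t) (hU : U z = 0) (hW : W z ≠ 0) :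
    ∃ z', z < z' ∧ z' ≤ z + ℓ ∧ W z' = 0 ∧
      (z' = z + ℓ → ∀ᵐ t ∂volume.restrict (Ioo z z'), a t = ν ^ 2) := by
  rcases hW.lt_or_gt with h1 | h1
  · simpa using h.neg.exists_critical_after_zero_of_pos hν hℓ hz hzL hage (by simp [hU])
      (by linarith)
  · exact h.exists_critical_after_zero_of_pos hν hℓ hz hzL hage hU h1

/-- Rolle-type statement: if `a > 0`, two critical points enclose a zero. -/
lemma exists_zero_between_critical (h : IsSystemSolution L a U W) {x y : ℝ} (hx : 0 ≤ x)
    (hy : y ≤ L) (hxy : x < y) (hapos : ∀ᵐ t ∂volume.restrict (Ioo 0 L), 0 < a t)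
    (hWx : W x = 0) (hWy : W y = 0) : ∃ z ∈ Ioo x y, U z = 0 := by
  by_contra hne
  push Not at hne
  have hxm : x ∈ Icc 0 L := ⟨hx, by linarith⟩
  have hym : y ∈ Icc 0 L := ⟨by linarith, hy⟩
  have hp := h.right.mono hxm hym
  have e := hp.integral_Ioo_eq hxy.le
  rw [hWx, hWy, sub_self, integral_neg, neg_eq_zero] at e
  have hint : IntegrableOn (fun t => a t * U t) (Ioo x y) := by
    simpa using (hp.integrableOn hxy.le).neg
  have hap : ∀ᵐ t ∂volume.restrict (Ioo x y), 0 < a t :=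
    ae_restrict_of_ae_restrict_of_subset (Ioo_subset_Ioo hx hy) hapos
  have hcont : ContinuousOn U (Ioo x y) := (h.left.continuousOn (hx.trans hxm.2)).mono
    (Ioo_subset_Icc_self.trans (Icc_subset_Icc hx hy))
  have hsign : (∀ t ∈ Ioo x y, 0 < U t) ∨ ∀ t ∈ Ioo x y, U t < 0 := by
    by_contra hcon
    push Not at hcon
    obtain ⟨⟨t1, ht1, h1⟩, t2, ht2, h2⟩ := hcon
    obtain ⟨r, hr, hr0⟩ := isPreconnected_Ioo.intermediate_value ht1 ht2 hcont ⟨h1, h2⟩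
    exact hne r hr hr0
  have hae : ∀ᵐ t ∂volume.restrict (Ioo x y), a t * U t = 0 := by
    rcases hsign with hs | hs
    · have hnn : 0 ≤ᵐ[volume.restrict (Ioo x y)] fun t => a t * U t := by
        filter_upwards [hap, ae_restrict_mem measurableSet_Ioo] with t h1 h2
        exact (mul_pos h1 (hs t h2)).le
      exact (integral_eq_zero_iff_of_nonneg_ae hnn hint).mp e
    · have hnn : 0 ≤ᵐ[volume.restrict (Ioo x y)] fun t => -(a t * U t) := by
        filter_upwards [hap, ae_restrict_mem measurableSet_Ioo] with t h1 h2
        exact neg_nonneg.mpr (mul_neg_of_pos_of_neg h1 (hs t h2)).le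
      have := (integral_eq_zero_iff_of_nonneg_ae hnn hint.neg).mp (by rw [integral_neg, e, neg_zero])
      filter_upwards [this] with t ht
      simpa using ht
  have hfalse : ∀ᵐ t ∂volume.restrict (Ioo x y), False := by
    filter_upwards [hae, hap, ae_restrict_mem measurableSet_Ioo] with t h1 h2 h3
    exact (mul_ne_zero h2.ne' (hne t h3)) h1
  rw [Filter.eventually_false_iff_eq_bot, ae_eq_bot, Measure.restrict_eq_zero] at hfalse
  simp at hfalse
  linarith

end IsSystemSolution

/-! ### The partition condition excludes nontrivial solutions -/

/-- The frequency `ν = n π / L`, whose square is the `n`-th Neumann eigenvalue. -/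
def freq (n : ℕ) (L : ℝ) : ℝ := (n : ℝ) * Real.pi / L

lemma neumannEigenvalue_eq (n : ℕ) (L : ℝ) : neumannEigenvalue n L = freq n L ^ 2 := by
  rw [neumannEigenvalue, freq]; ring

lemma freq_pos {n : ℕ} (hn : 1 ≤ n) {L : ℝ} (hL : 0 < L) : 0 < freq n L := by
  have : (0:ℝ) < n := by exact_mod_cast hn
  unfold freq; positivity

lemma freq_mul_quarter {n : ℕ} (hn : 1 ≤ n) {L : ℝ} (hL : 0 < L) :
    freq n L * (L / (2 * n)) = Real.pi / 2 := by
  have : (0:ℝ) < n := by exact_mod_cast hn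
  unfold freq; field_simp

lemma IsFinePartition.mem_Icc {n : ℕ} {L : ℝ} {y : Fin (2 * n + 3) → ℝ} (h : IsFinePartition n L y)
    (i : Fin (2 * n + 3)) : y i ∈ Icc 0 L :=
  ⟨h.zero ▸ h.strictMono.monotone (Fin.zero_le _), h.last ▸ h.strictMono.monotone (Fin.le_last _)⟩

lemma IsFinePartition.freq_mul_gap_lt {n : ℕ} (hn : 1 ≤ n) {L : ℝ} (hL : 0 < L)
    {y : Fin (2 * n + 3) → ℝ} (h : IsFinePartition n L y) (i : Fin (2 * n + 2)) :
    freq n L * (y i.succ - y i.castSucc) < Real.pi / 2 := by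
  rw [← freq_mul_quarter hn hL]
  exact mul_lt_mul_of_pos_left (h.gap_lt i) (freq_pos hn hL)

/-- Alternating critical points and zeros. If no piece of the partition contains both a zero and a
critical point of a nontrivial solution, then following critical points and zeros alternately from
`0`, the `k`-th one lies at or beyond `y k`; by Sturm comparison it also lies at or before
`k L / (2n)`. -/
lemma exists_alternating_point {n : ℕ} (hn : 1 ≤ n) {L : ℝ} (hL : 0 < L) {a U W : ℝ → ℝ}
    (h : IsSystemSolution L a U W) (hW0 : W 0 = 0) {y : Fin (2 * n + 3) → ℝ}
    (hy : IsFinePartition n L y)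
    (hage : ∀ᵐ t ∂volume.restrict (Ioo 0 L), freq n L ^ 2 ≤ a t)
    (hcauchy : ∀ z ∈ Icc 0 L, U z = 0 → W z ≠ 0)
    (hdis : ∀ i : Fin (2 * n + 2), ∀ p ∈ Icc (y i.castSucc) (y i.succ),
      ∀ q ∈ Icc (y i.castSucc) (y i.succ), U p = 0 → W q ≠ 0) (k : ℕ) (hk : k ≤ 2 * n) :
    ∃ z, z ≤ k * (L / (2 * n)) ∧ y ⟨k, by omega⟩ ≤ z ∧ (if Even k then W z = 0 else U z = 0) ∧
      (z = k * (L / (2 * n)) → ∀ᵐ t ∂volume.restrict (Ioo 0 z), a t = freq n L ^ 2) := by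
  have hn0 : (0:ℝ) < n := by exact_mod_cast hn
  have hℓ := freq_mul_quarter hn hL
  have hν := freq_pos hn hL
  induction k with
  | zero => exact ⟨0, by simp, by simp [hy.zero], by simp [hW0], by simp⟩
  | succ k ih =>
    obtain ⟨z, hz1, hz2, hz3, hz4⟩ := ih (by omega)
    have hz0 : 0 ≤ z := (hy.mem_Icc _).1.trans hz2
    have hkL : ((k + 1 : ℕ) : ℝ) * (L / (2 * n)) ≤ L := by
      rw [mul_div_assoc', div_le_iff₀ (by positivity), mul_comm]
      refine mul_le_mul_of_nonneg_left ?_ hL.le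
      exact_mod_cast hk
    have hkadd : ((k + 1 : ℕ) : ℝ) * (L / (2 * n)) = k * (L / (2 * n)) + L / (2 * n) := by
      push_cast; ring
    have hzL : z + L / (2 * n) ≤ L := by linarith
    have hℓ0 : 0 < L / (2 * (n:ℝ)) := by positivity
    have hzm : z ∈ Icc 0 L := ⟨hz0, by linarith⟩
    -- the next point, of the opposite kind
    obtain ⟨z', hzz', hz', hkind, hne, hrig⟩ : ∃ z', z < z' ∧ z' ≤ z + L / (2 * n) ∧
        (if Even (k + 1) then W z' = 0 else U z' = 0) ∧
        (¬ ∃ i : Fin (2 * n + 2), z ∈ Icc (y i.castSucc) (y i.succ) ∧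
          z' ∈ Icc (y i.castSucc) (y i.succ)) ∧
        (z' = z + L / (2 * n) → ∀ᵐ t ∂volume.restrict (Ioo z z'), a t = freq n L ^ 2) := by
      by_cases hev : Even k
      · rw [if_pos hev] at hz3
        obtain ⟨z', h1, h2, h3, h4⟩ := h.exists_zero_after_critical hν hℓ hz0 hzL hage
          (fun hU => hcauchy z hzm hU hz3) hz3
        refine ⟨z', h1, h2, ?_, ?_, h4⟩
        · rw [if_neg (by simpa [Nat.even_add_one] using hev)]; exact h3
        · rintro ⟨i, hi, hi'⟩
          exact hdis i z' hi' z hi h3 hz3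
      · rw [if_neg hev] at hz3
        obtain ⟨z', h1, h2, h3, h4⟩ := h.exists_critical_after_zero hν hℓ hz0 hzL hage
          hz3 (hcauchy z hzm hz3)
        refine ⟨z', h1, h2, ?_, ?_, h4⟩
        · rw [if_pos (by simpa [Nat.even_add_one] using hev)]; exact h3
        · rintro ⟨i, hi, hi'⟩
          exact hdis i z hi z' hi' hz3 h3
    refine ⟨z', by linarith, ?_, hkind, ?_⟩
    · by_contra hlt
      push Not at hlt
      refine hne ⟨⟨k, by omega⟩, ⟨hz2, hzz'.le.trans hlt.le⟩, ⟨hz2.trans hzz'.le, hlt.le⟩⟩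
    · intro he
      have e1 : z = k * (L / (2 * n)) := by linarith
      have e2 : z' = z + L / (2 * n) := by linarith
      have r1 := hz4 e1
      have r2 := hrig e2
      rw [ae_restrict_iff' measurableSet_Ioo] at r1 r2 ⊢
      filter_upwards [r1, r2, measure_eq_zero_iff_ae_notMem.mp (measure_singleton z)]
        with t t1 t2 t3 ht
      rcases lt_trichotomy t z with h1 | h1 | h1
      · exact t1 ⟨ht.1, h1⟩
      · exact absurd h1 t3
      · exact t2 ⟨h1, ht.2⟩

/-- The partition condition makes the Neumann problem nonresonant. -/
theorem isTrivial_of_partitionCondition {n : ℕ} (hn : 1 ≤ n) {L : ℝ} (hL : 0 < L) {a : ℝ → ℝ}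
    (ha : Admissible n L a) (hP : PartitionCondition n L a) {u : ℝ → ℝ}
    (hu : IsNeumannSolution L a u) : IsTrivial L u := by
  obtain ⟨hint, hge, hgt⟩ := ha
  obtain ⟨y, hy, hsmall⟩ := hP
  obtain ⟨U, W, h, hW0, hWL, huU⟩ := hu.exists_isSystemSolution hL hint
  have hν := freq_pos hn hL
  have hn0 : (0:ℝ) < n := by exact_mod_cast hn
  rw [neumannEigenvalue_eq] at hge hgt
  suffices hzero : ∀ x ∈ Icc 0 L, U x = 0 by
    filter_upwards [huU, ae_restrict_mem measurableSet_Ioo] with x hx hxm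
    rw [hx, hzero x (Ioo_subset_Icc_self hxm)]
  by_contra hnz
  have hcauchy : ∀ z ∈ Icc 0 L, U z = 0 → W z ≠ 0 := fun z hz h1 h2 =>
    hnz (h.eq_zero_of_cauchy hint hz h1 h2)
  have hdis : ∀ i : Fin (2 * n + 2), ∀ p ∈ Icc (y i.castSucc) (y i.succ),
      ∀ q ∈ Icc (y i.castSucc) (y i.succ), U p = 0 → W q ≠ 0 := by
    intro i p hp q hq h1 h2
    have hs := hsmall i
    rw [neumannEigenvalue_eq, mul_div_right_comm _ (y i.succ - y i.castSucc)] at hs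
    exact hnz (h.eq_zero_of_disfocal hint hν (hy.mem_Icc _) (hy.mem_Icc _)
      (hy.freq_mul_gap_lt hn hL i) hs hp hq h1 h2)
  obtain ⟨z, hz1, hz2, hz3, hz4⟩ :=
    exists_alternating_point hn hL h hW0 hy hge hcauchy hdis (2 * n) le_rfl
  rw [if_pos (even_two_mul n)] at hz3
  have hLL : ((2 * n : ℕ) : ℝ) * (L / (2 * n)) = L := by push_cast; field_simp
  rw [hLL] at hz1 hz4
  have hz0 : 0 ≤ z := (hy.mem_Icc _).1.trans hz2
  rcases hz1.eq_or_lt with rfl | hzL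
  · have h1 := hz4 rfl
    rw [ae_restrict_iff' measurableSet_Ioo] at h1
    refine hgt.ne' (measure_eq_zero_iff_ae_notMem.mpr ?_)
    filter_upwards [h1] with t ht hmem
    exact absurd hmem.2 (not_lt.mpr (ht hmem.1).le)
  · have hpos : ∀ᵐ t ∂volume.restrict (Ioo 0 L), 0 < a t := by
      filter_upwards [hge] with t ht
      exact lt_of_lt_of_le (by positivity) ht
    obtain ⟨p, hp, hUp⟩ := h.exists_zero_between_critical hz0 le_rfl hzL hpos hz3 hWL
    -- `z`, `p`, `L` alternate in kind but only two pieces of the partition are left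
    by_cases hpy : p ≤ y ⟨2 * n + 1, by omega⟩
    · exact hdis ⟨2 * n, by omega⟩ p ⟨hz2.trans hp.1.le, hpy⟩ z ⟨hz2, hp.1.le.trans hpy⟩ hUp hz3
    · push Not at hpy
      have hlast : y ⟨2 * n + 2, by omega⟩ = L := hy.last
      refine hdis ⟨2 * n + 1, by omega⟩ p ⟨hpy.le, ?_⟩ L ⟨hpy.le.trans hp.2.le, ?_⟩ hUp hWL
      · exact hp.2.le.trans hlast.ge
      · exact hlast.ge

/-! ### Convexity of the cotangent -/

lemma hasDerivAt_cot {x : ℝ} (hx : Real.sin x ≠ 0) :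
    HasDerivAt Real.cot (-(1 / Real.sin x ^ 2)) x := by
  have h := (Real.hasDerivAt_cos x).div (Real.hasDerivAt_sin x) hx
  have hfun : Real.cot = fun y => Real.cos y / Real.sin y :=
    funext fun y => Real.cot_eq_cos_div_sin y
  rw [hfun]
  refine h.congr_deriv ?_
  have := Real.sin_sq_add_cos_sq x
  rw [← this]
  field_simp
  ring

lemma sin_pos_of_mem {x : ℝ} (hx : x ∈ Ioo 0 (Real.pi / 2)) : 0 < Real.sin x :=
  Real.sin_pos_of_pos_of_lt_pi hx.1 (by linarith [hx.2, Real.pi_pos])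

lemma cot_pos {x : ℝ} (hx : x ∈ Ioo 0 (Real.pi / 2)) : 0 < Real.cot x := by
  rw [Real.cot_eq_cos_div_sin]
  exact div_pos (Real.cos_pos_of_mem_Ioo ⟨by linarith [hx.1, Real.pi_pos], hx.2⟩)
    (sin_pos_of_mem hx)

lemma cot_le_cot {x y : ℝ} (hx : 0 < x) (hxy : x ≤ y) (hy : y < Real.pi / 2) :
    Real.cot y ≤ Real.cot x := by
  have h1 := sin_pos_of_mem ⟨hx, hxy.trans_lt hy⟩
  have h2 := sin_pos_of_mem ⟨hx.trans_le hxy, hy⟩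
  rw [Real.cot_eq_cos_div_sin, Real.cot_eq_cos_div_sin, div_le_div_iff₀ h2 h1]
  have : 0 ≤ Real.sin (y - x) :=
    Real.sin_nonneg_of_nonneg_of_le_pi (by linarith) (by linarith)
  rw [Real.sin_sub] at this
  linarith

lemma strictConvexOn_cot : StrictConvexOn ℝ (Ioo 0 (Real.pi / 2)) Real.cot := by
  refine StrictMonoOn.strictConvexOn_of_deriv (convex_Ioo _ _) ?_ ?_
  · intro x hx
    exact (hasDerivAt_cot (sin_pos_of_mem hx).ne').continuousAt.continuousWithinAt
  · rw [interior_Ioo]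
    intro x hx y hy hxy
    rw [(hasDerivAt_cot (sin_pos_of_mem hx).ne').deriv,
      (hasDerivAt_cot (sin_pos_of_mem hy).ne').deriv, neg_lt_neg_iff]
    refine one_div_lt_one_div_of_lt (pow_pos (sin_pos_of_mem hx) 2) ?_
    refine pow_lt_pow_left₀ ?_ (sin_pos_of_mem hx).le (by norm_num)
    exact Real.sin_lt_sin_of_lt_of_le_pi_div_two (by linarith [hx.1, Real.pi_pos]) hy.2.le hxy

lemma card_mul_cot_mean_le {N : ℕ} (hN : 0 < N) {ν : ℝ} {d : Fin N → ℝ}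
    (hd : ∀ i, ν * d i ∈ Ioo 0 (Real.pi / 2)) :
    N * Real.cot (ν * ((∑ i, d i) / N)) ≤ ∑ i, Real.cot (ν * d i) := by
  have hN0 : (0:ℝ) < N := by exact_mod_cast hN
  have h := strictConvexOn_cot.convexOn.map_sum_le (t := Finset.univ) (w := fun _ : Fin N => 1 / (N:ℝ))
    (p := fun i => ν * d i) (fun _ _ => by positivity) (by simp; field_simp) (fun i _ => hd i)
  simp only [smul_eq_mul, ← Finset.mul_sum] at h
  rw [show 1 / (N:ℝ) * (ν * ∑ i, d i) = ν * ((∑ i, d i) / N) by ring] at h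
  rw [one_div_mul_eq_div, le_div_iff₀ hN0] at h
  linarith

lemma card_mul_cot_mean_lt {N : ℕ} (hN : 0 < N) {ν : ℝ} (hν : ν ≠ 0) {d : Fin N → ℝ}
    (hd : ∀ i, ν * d i ∈ Ioo 0 (Real.pi / 2)) (hne : ∃ i j, d i ≠ d j) :
    N * Real.cot (ν * ((∑ i, d i) / N)) < ∑ i, Real.cot (ν * d i) := by
  have hN0 : (0:ℝ) < N := by exact_mod_cast hN
  obtain ⟨i, j, hij⟩ := hne
  have h := strictConvexOn_cot.map_sum_lt (t := Finset.univ) (w := fun _ : Fin N => 1 / (N:ℝ))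
    (p := fun i => ν * d i) (fun _ _ => by positivity) (by simp; field_simp) (fun i _ => hd i)
    ⟨i, Finset.mem_univ _, j, Finset.mem_univ _, fun e => hij (mul_left_cancel₀ hν e)⟩
  simp only [smul_eq_mul, ← Finset.mul_sum] at h
  rw [show 1 / (N:ℝ) * (ν * ∑ i, d i) = ν * ((∑ i, d i) / N) by ring] at h
  rw [one_div_mul_eq_div, lt_div_iff₀ hN0] at h
  linarith

/-- The sum of the bounds `ν cot (ν d)` over the partition of `(0, L)` into `2n + 2` equal pieces,
which dominates the Lyapunov constant. -/
def equalPartitionBound (n : ℕ) (L : ℝ) : ℝ :=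
  (2 * n + 2) * (freq n L * Real.cot (freq n L * (L / (2 * n + 2))))

lemma freq_mul_equal_piece_mem {n : ℕ} (hn : 1 ≤ n) {L : ℝ} (hL : 0 < L) :
    freq n L * (L / (2 * n + 2)) ∈ Ioo 0 (Real.pi / 2) := by
  have hn0 : (0:ℝ) < n := by exact_mod_cast hn
  refine ⟨mul_pos (freq_pos hn hL) (by positivity), ?_⟩
  rw [← freq_mul_quarter hn hL]
  exact mul_lt_mul_of_pos_left (div_lt_div_of_pos_left hL (by positivity) (by linarith))
    (freq_pos hn hL)

/-! ### From small total mass to a partition -/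

lemma exists_next_point {G : ℝ → ℝ} (hG : Continuous G) (hmono : StrictMono G) {ν : ℝ}
    (hν : 0 < ν) (y : ℝ) :
    ∃ y', ν * (y' - y) ∈ Ioo 0 (Real.pi / 2) ∧ G y' - G y = ν * Real.cot (ν * (y' - y)) := by
  set ℓ := Real.pi / 2 / ν
  have hℓ : ν * ℓ = Real.pi / 2 := by simp only [ℓ]; field_simp
  have hℓ0 : 0 < ℓ := by positivity
  set H : ℝ → ℝ := fun d => (G (y + d) - G y) * Real.sin (ν * d) - ν * Real.cos (ν * d)
  have hH : Continuous H := by fun_prop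
  have h0 : H 0 < 0 := by simp [H, hν]
  have h1 : 0 < H ℓ := by
    simp only [H, hℓ, Real.sin_pi_div_two, Real.cos_pi_div_two]
    linarith [hmono (show y < y + ℓ by linarith)]
  obtain ⟨d, hd, hd0⟩ := intermediate_value_Icc hℓ0.le hH.continuousOn ⟨h0.le, h1.le⟩
  have hdpos : 0 < d := lt_of_le_of_ne hd.1 fun e => h0.ne (e ▸ hd0)
  have hdlt : d < ℓ := lt_of_le_of_ne hd.2 fun e => h1.ne' (e ▸ hd0)
  have hmem : ν * d ∈ Ioo 0 (Real.pi / 2) :=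
    ⟨mul_pos hν hdpos, hℓ ▸ mul_lt_mul_of_pos_left hdlt hν⟩
  refine ⟨y + d, by simpa using hmem, ?_⟩
  rw [add_sub_cancel_left, Real.cot_eq_cos_div_sin, mul_div_assoc', eq_div_iff
    (sin_pos_of_mem hmem).ne']
  simp only [H] at hd0
  linarith

/-- Greedy choice of points: each piece carries exactly the critical mass `ν cot (ν d)`. By Jensen's
inequality `N` such pieces inside `[0, L]` would carry at least `N ν cot (ν L / N)`. -/
lemma exists_greedy_points {G : ℝ → ℝ} (hG : Continuous G) (hmono : StrictMono G) {ν L : ℝ}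
    (hν : 0 < ν) {N : ℕ} (hN : 0 < N) (hνL : ν * (L / N) < Real.pi / 2)
    (hlt : G L - G 0 < N * (ν * Real.cot (ν * (L / N)))) :
    ∃ y : ℕ → ℝ, y 0 = 0 ∧ L < y N ∧ ∀ k, ν * (y (k + 1) - y k) ∈ Ioo 0 (Real.pi / 2) ∧
      G (y (k + 1)) - G (y k) = ν * Real.cot (ν * (y (k + 1) - y k)) := by
  have hN0 : (0:ℝ) < N := by exact_mod_cast hN
  choose next hnext using exists_next_point hG hmono hν
  set y : ℕ → ℝ := fun k => next^[k] 0
  have hy : ∀ k, y (k + 1) = next (y k) := fun k => Function.iterate_succ_apply' next k 0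
  have hstep : ∀ k, ν * (y (k + 1) - y k) ∈ Ioo 0 (Real.pi / 2) ∧
      G (y (k + 1)) - G (y k) = ν * Real.cot (ν * (y (k + 1) - y k)) := fun k => by
    rw [hy]; exact hnext (y k)
  refine ⟨y, rfl, ?_, hstep⟩
  by_contra hcon
  push Not at hcon
  have hJ := card_mul_cot_mean_le hN (ν := ν) (d := fun i : Fin N => y (i + 1) - y i)
    fun i => (hstep i).1
  have hsum : ∑ i : Fin N, (y (i + 1) - y i) = y N := by
    rw [Fin.sum_univ_eq_sum_range (fun k => y (k + 1) - y k) N, Finset.sum_range_sub]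
    simp [y]
  have hsumG : ∑ i : Fin N, ν * Real.cot (ν * (y (i + 1) - y i)) = G (y N) - G 0 := by
    rw [Finset.sum_congr rfl fun (i : Fin N) _ => (hstep i).2.symm,
      Fin.sum_univ_eq_sum_range (fun k => G (y (k + 1)) - G (y k)) N,
      Finset.sum_range_sub (fun k => G (y k))]
    simp [y]
  rw [← Finset.mul_sum] at hsumG
  rw [hsum] at hJ
  have hyN : 0 < y N := by
    rw [← hsum]
    have : Nonempty (Fin N) := ⟨⟨0, hN⟩⟩
    exact Finset.sum_pos (fun i _ => pos_of_mul_pos_right (hstep i).1.1 hν.le)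
      Finset.univ_nonempty
  have hcot : Real.cot (ν * (L / N)) ≤ Real.cot (ν * (y N / N)) :=
    cot_le_cot (by positivity) (by gcongr) hνL
  have hGle : G (y N) ≤ G L := hmono.monotone hcon
  have : N * (ν * Real.cot (ν * (L / N))) ≤ ν * ∑ i : Fin N, Real.cot (ν * (y (i + 1) - y i)) := by
    calc N * (ν * Real.cot (ν * (L / N))) = ν * (N * Real.cot (ν * (L / N))) := by ring
      _ ≤ ν * (N * Real.cot (ν * (y N / N))) := by gcongr
      _ ≤ _ := by gcongr
  linarith

lemma exists_small_length {ν M K : ℝ} (hν : 0 < ν) (hK : 0 < K) :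
    ∃ η, 0 < η ∧ η < K ∧ ν * η < Real.pi / 2 ∧ M < ν * Real.cot (ν * η) := by
  have h1 : ∀ᶠ η in nhds (0:ℝ), M * Real.sin (ν * η) - ν * Real.cos (ν * η) < 0 := by
    refine (Continuous.tendsto (by fun_prop) 0).eventually_lt_const ?_
    simp [hν]
  have h2 : ∀ᶠ η in nhds (0:ℝ), ν * η < Real.pi / 2 := by
    refine (Continuous.tendsto (by fun_prop) 0).eventually_lt_const ?_
    simpa using Real.pi_div_two_pos
  have h3 : ∀ᶠ η in nhds (0:ℝ), η < K := eventually_lt_nhds hK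
  have h4 := (h1.and (h2.and h3)).filter_mono (nhdsWithin_le_nhds (s := Ioi 0))
  obtain ⟨η, ⟨e1, e2, e3⟩, e4⟩ := (h4.and self_mem_nhdsWithin).exists
  have e4' : 0 < η := e4
  refine ⟨η, e4', e3, e2, ?_⟩
  rw [Real.cot_eq_cos_div_sin, mul_div_assoc', lt_div_iff₀ (sin_pos_of_mem ⟨by positivity, e2⟩)]
  linarith

lemma normL1_mono {L c e : ℝ} {f : ℝ → ℝ} (hf : IntegrableOn f (Ioo 0 L)) (hc : 0 ≤ c)
    (he : e ≤ L) : normL1 c e f ≤ normL1 0 L f :=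
  setIntegral_mono_set hf.abs (Filter.Eventually.of_forall fun _ => abs_nonneg _)
    (Filter.Eventually.of_forall (Ioo_subset_Ioo hc he))

/-- Total mass below the bound of the equal partition yields a good partition. -/
theorem partitionCondition_of_normL1_lt {n : ℕ} (hn : 1 ≤ n) {L : ℝ} (hL : 0 < L) {a : ℝ → ℝ}
    (ha : IntegrableOn a (Ioo 0 L))
    (hlt : normL1 0 L (fun x => a x - neumannEigenvalue n L) < equalPartitionBound n L) :
    PartitionCondition n L a := by
  have hn0 : (0:ℝ) < n := by exact_mod_cast hn
  set ν := freq n L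
  have hν : 0 < ν := freq_pos hn hL
  set f : ℝ → ℝ := fun x => a x - neumannEigenvalue n L
  have hf : IntegrableOn f (Ioo 0 L) := ha.sub (integrableOn_const (by simp))
  set M := normL1 0 L f
  set g : ℝ → ℝ := (Ioo 0 L).indicator fun x => |f x|
  have hg : Integrable g := (integrable_indicator_iff measurableSet_Ioo).mpr hf.abs
  have hg0 : ∀ x, 0 ≤ g x := fun x => indicator_nonneg (fun _ _ => abs_nonneg _) x
  -- a small linear term makes the cumulative mass strictly increasing and the final bounds strict
  set ε := (equalPartitionBound n L - M) / (2 * L)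
  have hε : 0 < ε := div_pos (by linarith) (by linarith)
  set G : ℝ → ℝ := fun x => (∫ t in (0:ℝ)..x, g t) + ε * x
  have hGc : Continuous G :=
    (intervalIntegral.continuous_primitive (fun _ _ => hg.intervalIntegrable) 0).add (by fun_prop)
  have hGdiff : ∀ x y, G y - G x = (∫ t in x..y, g t) + ε * (y - x) := fun x y => by
    simp only [G]
    rw [← intervalIntegral.integral_interval_sub_left (a := 0) (b := y) (c := x)
      hg.intervalIntegrable hg.intervalIntegrable]
    ring
  have hGm : StrictMono G := fun x y hxy => by
    have h1 := hGdiff x y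
    have h2 : 0 ≤ ∫ t in x..y, g t :=
      intervalIntegral.integral_nonneg hxy.le fun t _ => hg0 t
    nlinarith
  have hmass : ∀ c e, 0 ≤ c → c ≤ e → e ≤ L → normL1 c e f = ∫ t in c..e, g t := by
    intro c e hc hce he
    rw [intervalIntegral.integral_of_le hce, integral_Ioc_eq_integral_Ioo, normL1]
    refine setIntegral_congr_fun measurableSet_Ioo fun t ht => ?_
    simp only [g]
    rw [indicator_of_mem (Ioo_subset_Ioo hc he ht)]
  have hN : ((2 * n + 2 : ℕ) : ℝ) = 2 * n + 2 := by push_cast; ring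
  have hGL : G L - G 0 < ((2 * n + 2 : ℕ) : ℝ) *
      (ν * Real.cot (ν * (L / ((2 * n + 2 : ℕ) : ℝ)))) := by
    rw [hN, hGdiff, ← hmass 0 L le_rfl hL.le le_rfl, sub_zero]
    have h1 : ε * L = (equalPartitionBound n L - M) / 2 := by simp only [ε]; field_simp
    rw [h1]
    change M + (equalPartitionBound n L - M) / 2 < equalPartitionBound n L
    linarith
  obtain ⟨y, hy0, hyN, hstep⟩ := exists_greedy_points hGc hGm hν (by omega)
    (by rw [hN]; exact (freq_mul_equal_piece_mem hn hL).2) hGL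
  obtain ⟨η, hη0, hηK, hηπ, hηM⟩ := exists_small_length (M := M) hν
    (show 0 < L / (2 * n + 2) by positivity)
  -- truncate at `L`, keeping room of length `η` for each remaining piece
  set Y : ℕ → ℝ := fun i => min (y i) (L - (2 * n + 2 - i) * η)
  have hYmono : ∀ i, Y i < Y (i + 1) := by
    intro i
    refine min_lt_min ?_ ?_
    · linarith [pos_of_mul_pos_right (hstep i).1.1 hν.le]
    · push_cast; nlinarith
  have hYsm : StrictMono Y := strictMono_nat_of_lt_succ hYmono
  have hY0 : Y 0 = 0 := by
    rw [lt_div_iff₀ (by positivity)] at hηK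
    simp only [Y, hy0]
    refine min_eq_left ?_
    push_cast
    linarith
  have hYN : Y (2 * n + 2) = L := by
    simp only [Y]
    push_cast
    rw [min_eq_right] <;> linarith
  have hpiece : ∀ i, i < 2 * n + 2 → ν * (Y (i + 1) - Y i) < Real.pi / 2 ∧
      normL1 (Y i) (Y (i + 1)) f < ν * Real.cot (ν * (Y (i + 1) - Y i)) := by
    intro i hi
    have hgap : 0 < ν * (Y (i + 1) - Y i) := mul_pos hν (by linarith [hYmono i])
    have h0 : 0 ≤ Y i := hY0 ▸ hYsm.monotone (Nat.zero_le i)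
    have h1 : Y (i + 1) ≤ L := hYN ▸ hYsm.monotone (by omega)
    rcases min_choice (y i) (L - (2 * n + 2 - i) * η) with hc | hc
    · have hYi : Y i = y i := hc
      have hYi1 : Y (i + 1) ≤ y (i + 1) := min_le_left _ _
      have hle : ν * (Y (i + 1) - Y i) ≤ ν * (y (i + 1) - y i) :=
        mul_le_mul_of_nonneg_left (by linarith) hν.le
      refine ⟨hle.trans_lt (hstep i).1.2, ?_⟩
      have e1 := hGdiff (Y i) (Y (i + 1))
      have e2 : G (Y (i + 1)) ≤ G (y (i + 1)) := hGm.monotone hYi1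
      have e3 := (hstep i).2
      have e4 : Real.cot (ν * (y (i + 1) - y i)) ≤ Real.cot (ν * (Y (i + 1) - Y i)) :=
        cot_le_cot hgap hle (hstep i).1.2
      rw [hmass _ _ h0 (hYmono i).le h1]
      have e5 : 0 < ε * (Y (i + 1) - Y i) := mul_pos hε (by linarith [hYmono i])
      have e6 := mul_le_mul_of_nonneg_left e4 hν.le
      rw [hYi] at e1 e5 e6 ⊢
      linarith
    · have hYi : Y i = L - (2 * n + 2 - i) * η := hc
      have hYi1 : Y (i + 1) ≤ L - (2 * n + 2 - (i + 1 : ℕ)) * η := min_le_right _ _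
      push_cast at hYi1
      have hle : ν * (Y (i + 1) - Y i) ≤ ν * η :=
        mul_le_mul_of_nonneg_left (by linarith) hν.le
      refine ⟨hle.trans_lt hηπ, ?_⟩
      calc normL1 (Y i) (Y (i + 1)) f ≤ M := normL1_mono hf h0 h1
        _ < ν * Real.cot (ν * η) := hηM
        _ ≤ _ := mul_le_mul_of_nonneg_left (cot_le_cot hgap hle hηπ) hν.le
  refine ⟨fun i => Y i, ⟨hY0, hYN, fun i j hij => hYsm hij, fun i => ?_⟩, fun i => ?_⟩
  · have := (hpiece i i.2).1
    rw [← freq_mul_quarter hn hL] at this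
    exact lt_of_mul_lt_mul_left this hν.le
  · rw [mul_div_right_comm _ (_ - _ : ℝ)]
    exact (hpiece i i.2).2

/-! ### Potentials adapted to an unequal partition -/

/-- On a partition with two different gaps, masses proportional to `ν cot (ν d)` can be chosen below
the bound on each piece and with total mass `equalPartitionBound n L`, by strict convexity. -/
theorem exists_admissible_smallOnPieces {n : ℕ} (hn : 1 ≤ n) {L : ℝ} (hL : 0 < L)
    {y : Fin (2 * n + 3) → ℝ} (hy : IsFinePartition n L y)
    (hne : ∃ i j : Fin (2 * n + 2), y i.succ - y i.castSucc ≠ y j.succ - y j.castSucc) :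
    ∃ a : ℝ → ℝ, Admissible n L a ∧ SmallOnPieces n L y a ∧
      normL1 0 L (fun x => a x - neumannEigenvalue n L) = equalPartitionBound n L := by
  have hn0 : (0:ℝ) < n := by exact_mod_cast hn
  set ν := freq n L
  have hν : 0 < ν := freq_pos hn hL
  set d : Fin (2 * n + 2) → ℝ := fun i => y i.succ - y i.castSucc
  have hd0 : ∀ i, 0 < d i := fun i => sub_pos.mpr (hy.strictMono Fin.castSucc_lt_succ)
  have hd : ∀ i, ν * d i ∈ Ioo 0 (Real.pi / 2) := fun i =>
    ⟨mul_pos hν (hd0 i), hy.freq_mul_gap_lt hn hL i⟩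
  have hsum : ∑ i, d i = L := by
    have h1 : ∑ i : Fin (2 * n + 2), (y i.succ - y i.castSucc) = y (Fin.last _) - y 0 := by
      rw [Finset.sum_sub_distrib]
      have e1 := Fin.sum_univ_succ y
      have e2 := Fin.sum_univ_castSucc y
      linarith
    rw [hy.last, hy.zero, sub_zero] at h1
    exact h1
  set S := ∑ i, ν * Real.cot (ν * d i)
  have hB0 : 0 < equalPartitionBound n L :=
    mul_pos (by positivity) (mul_pos hν (cot_pos (freq_mul_equal_piece_mem hn hL)))
  have hBS : equalPartitionBound n L < S := by
    have h := card_mul_cot_mean_lt (by omega) hν.ne' hd hne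
    rw [hsum] at h
    push_cast at h
    have h' := mul_lt_mul_of_pos_left h hν
    rw [Finset.mul_sum] at h'
    calc equalPartitionBound n L = ν * ((2 * n + 2) * Real.cot (ν * (L / (2 * n + 2)))) := by
          simp only [equalPartitionBound, ν]; ring
      _ < S := h'
  set t := equalPartitionBound n L / S
  have hS0 : 0 < S := hB0.trans hBS
  have ht0 : 0 < t := div_pos hB0 hS0
  have ht1 : t < 1 := (div_lt_one hS0).mpr hBS
  set c : Fin (2 * n + 2) → ℝ := fun i => t * (ν * Real.cot (ν * d i)) / d i
  have hcd : ∀ i, c i * d i = t * (ν * Real.cot (ν * d i)) := fun i =>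
    div_mul_cancel₀ _ (hd0 i).ne'
  have hc0 : ∀ i, 0 < c i := fun i =>
    div_pos (mul_pos ht0 (mul_pos hν (cot_pos (hd i)))) (hd0 i)
  set I : Fin (2 * n + 2) → Set ℝ := fun i => Ioo (y i.castSucc) (y i.succ)
  set b : ℝ → ℝ := fun x => ∑ i, (I i).indicator (fun _ => c i) x
  have hIL : ∀ i, I i ⊆ Ioo 0 L := fun i =>
    Ioo_subset_Ioo (hy.mem_Icc _).1 (hy.mem_Icc _).2
  have hb0 : ∀ x, 0 ≤ b x := fun x =>
    Finset.sum_nonneg fun i _ => indicator_nonneg (fun _ _ => (hc0 i).le) x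
  have hbI : ∀ i, ∀ x ∈ I i, b x = c i := by
    intro i x hx
    simp only [b]
    rw [Finset.sum_eq_single i, indicator_of_mem hx]
    · intro j _ hji
      refine indicator_of_notMem (fun hxj => ?_) _
      rcases lt_or_gt_of_ne hji with h | h
      · have : y j.succ ≤ y i.castSucc := hy.strictMono.monotone (by
          rw [Fin.le_iff_val_le_val]; simpa using h)
        linarith [hx.1, hxj.2]
      · have : y i.succ ≤ y j.castSucc := hy.strictMono.monotone (by
          rw [Fin.le_iff_val_le_val]; simpa using h)
        linarith [hx.2, hxj.1]
    · simp
  have hind : ∀ i, IntegrableOn ((I i).indicator fun _ => c i) (Ioo 0 L) := fun i =>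
    (integrableOn_const (by simp)).indicator measurableSet_Ioo
  have hbint : IntegrableOn b (Ioo 0 L) := integrable_finsetSum _ fun i _ => hind i
  have hvol : ∀ i, volume.real (I i) = d i := fun i => by
    simp only [I, Real.volume_real_Ioo_of_le (sub_pos.mp (hd0 i)).le, d]
  set a : ℝ → ℝ := fun x => neumannEigenvalue n L + b x
  have hab : ∀ x, a x - neumannEigenvalue n L = b x := fun x => add_sub_cancel_left _ _
  refine ⟨a, ⟨(integrableOn_const (by simp)).add hbint, ?_, ?_⟩, fun i => ?_, ?_⟩
  · exact Filter.Eventually.of_forall fun x => le_add_of_nonneg_right (hb0 x)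
  · have hsub : I 0 ⊆ {x | x ∈ Ioo 0 L ∧ neumannEigenvalue n L < a x} := fun x hx =>
      ⟨hIL 0 hx, lt_add_of_pos_right _ (by rw [hbI 0 x hx]; exact hc0 0)⟩
    refine lt_of_lt_of_le ?_ (measure_mono hsub)
    simp only [I, Real.volume_Ioo, ENNReal.ofReal_pos]
    exact hd0 0
  · rw [mul_div_right_comm _ (_ - _ : ℝ)]
    have : normL1 (y i.castSucc) (y i.succ) (fun x => a x - neumannEigenvalue n L) = c i * d i := by
      simp only [normL1, hab]
      rw [setIntegral_congr_fun (g := fun _ => c i) measurableSet_Ioo fun x hx => by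
        simp only; rw [abs_of_nonneg (hb0 x), hbI i x hx]]
      rw [setIntegral_const, hvol i, smul_eq_mul, mul_comm]
    rw [this, hcd]
    exact mul_lt_of_lt_one_left (mul_pos hν (cot_pos (hd i))) ht1
  · simp only [normL1, hab]
    simp only [abs_of_nonneg (hb0 _)]
    simp only [b]
    rw [integral_finsetSum _ fun i _ => hind i]
    have : ∀ i, ∫ x in Ioo 0 L, (I i).indicator (fun _ => c i) x = c i * d i := fun i => by
      rw [setIntegral_indicator measurableSet_Ioo, inter_eq_self_of_subset_right (hIL i),
        setIntegral_const, hvol i, smul_eq_mul, mul_comm]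
    simp only [this, hcd]
    rw [← Finset.mul_sum]
    exact div_mul_cancel₀ _ hS0.ne'

/-! ### Resonant potentials of nearly minimal mass -/

/-- A smoothed triangle wave; as `r → 1` it tends to the triangle wave `arcsin (cos (κ x))`. -/
def phase (κ r x : ℝ) : ℝ := Real.arcsin (r * Real.cos (κ * x))

/-- The first derivative of `phase`. -/
def phaseDeriv (κ r x : ℝ) : ℝ := -(r * κ * Real.sin (κ * x)) / Real.cos (phase κ r x)

/-- The excess `a - (ρ κ)²`, as a function of the phase `s`, of the potential `a = -U'' / U` for
which `U = sin (ρ s)` solves `U'' + a U = 0`. At the zeros of `U`, where the quotient is undefined,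
the value is `1`. -/
def excess (κ ρ r s : ℝ) : ℝ :=
  if s = 0 then 1 else (1 - r ^ 2) * κ ^ 2 * ρ / Real.cos s ^ 2 *
    (Real.cos (ρ * s) / Real.sin (ρ * s) * (Real.sin s / Real.cos s) - ρ)

section phase

variable {κ ρ r : ℝ}

lemma abs_mul_cos_lt_one (hr : r ∈ Ioo 0 1) (θ : ℝ) : |r * Real.cos θ| < 1 := by
  rw [abs_mul, abs_of_pos hr.1]
  nlinarith [Real.abs_cos_le_one θ, hr.1, hr.2, abs_nonneg (Real.cos θ)]

lemma phase_mem (hr : r ∈ Ioo 0 1) (x : ℝ) : phase κ r x ∈ Ioo (-(Real.pi / 2)) (Real.pi / 2) := by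
  have h := abs_lt.mp (abs_mul_cos_lt_one hr (κ * x))
  exact ⟨Real.neg_pi_div_two_lt_arcsin.mpr h.1, Real.arcsin_lt_pi_div_two.mpr h.2⟩

lemma cos_phase_pos (hr : r ∈ Ioo 0 1) (x : ℝ) : 0 < Real.cos (phase κ r x) :=
  Real.cos_pos_of_mem_Ioo (phase_mem hr x)

lemma sin_phase (hr : r ∈ Ioo 0 1) (x : ℝ) : Real.sin (phase κ r x) = r * Real.cos (κ * x) := by
  have h := abs_lt.mp (abs_mul_cos_lt_one hr (κ * x))
  exact Real.sin_arcsin h.1.le h.2.le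

lemma cos_sq_phase (hr : r ∈ Ioo 0 1) (x : ℝ) :
    Real.cos (phase κ r x) ^ 2 = 1 - r ^ 2 + r ^ 2 * Real.sin (κ * x) ^ 2 := by
  rw [Real.cos_sq', sin_phase hr, mul_pow, Real.cos_sq']
  ring

lemma continuous_phase : Continuous (phase κ r) := by
  unfold phase; fun_prop

lemma hasDerivAt_phase (hr : r ∈ Ioo 0 1) (x : ℝ) :
    HasDerivAt (phase κ r) (phaseDeriv κ r x) x := by
  have h := abs_lt.mp (abs_mul_cos_lt_one hr (κ * x))
  have h1 : HasDerivAt (fun x => r * Real.cos (κ * x)) (-(r * κ * Real.sin (κ * x))) x := by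
    have : HasDerivAt (fun x => κ * x) κ x := by simpa using (hasDerivAt_id x).const_mul κ
    exact (this.cos.const_mul r).congr_deriv (by ring)
  have h2 := (Real.hasDerivAt_arcsin h.1.ne' h.2.ne).comp x h1
  refine h2.congr_deriv ?_
  rw [phaseDeriv, phase, Real.cos_arcsin]
  ring

lemma hasDerivAt_phaseDeriv (hr : r ∈ Ioo 0 1) (x : ℝ) :
    HasDerivAt (phaseDeriv κ r)
      (-((1 - r ^ 2) * κ ^ 2 * Real.sin (phase κ r x) / Real.cos (phase κ r x) ^ 3)) x := by
  have hc := (cos_phase_pos (κ := κ) hr x).ne'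
  have h1 : HasDerivAt (fun x => -(r * κ * Real.sin (κ * x)))
      (-(κ ^ 2 * Real.sin (phase κ r x))) x := by
    have : HasDerivAt (fun x => κ * x) κ x := by simpa using (hasDerivAt_id x).const_mul κ
    refine (this.sin.const_mul (r * κ)).neg.congr_deriv ?_
    rw [sin_phase hr]; ring
  refine (h1.div (hasDerivAt_phase hr x).cos hc).congr_deriv ?_
  have hsq := cos_sq_phase (κ := κ) hr x
  rw [phaseDeriv, div_eq_iff (pow_ne_zero 2 hc)]
  field_simp
  rw [hsq]
  ring

lemma phaseDeriv_sq (hr : r ∈ Ioo 0 1) (x : ℝ) :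
    phaseDeriv κ r x ^ 2 = κ ^ 2 - (1 - r ^ 2) * κ ^ 2 / Real.cos (phase κ r x) ^ 2 := by
  have hc := (cos_phase_pos (κ := κ) hr x).ne'
  have hsq := cos_sq_phase (κ := κ) hr x
  rw [phaseDeriv, div_pow, eq_sub_iff_add_eq, ← add_div, div_eq_iff (pow_ne_zero 2 hc), hsq]
  ring

lemma excess_neg (s : ℝ) : excess κ ρ r (-s) = excess κ ρ r s := by
  simp only [excess, neg_eq_zero, mul_neg, Real.cos_neg, Real.sin_neg, neg_div, div_neg, neg_neg,
    neg_mul]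

lemma excess_abs (s : ℝ) : excess κ ρ r |s| = excess κ ρ r s := by
  rcases abs_choice s with h | h <;> rw [h]
  exact excess_neg s

lemma excess_of_ne {s : ℝ} (hs : s ≠ 0) : excess κ ρ r s =
    (1 - r ^ 2) * κ ^ 2 * ρ / Real.cos s ^ 2 *
      (Real.cos (ρ * s) / Real.sin (ρ * s) * (Real.sin s / Real.cos s) - ρ) :=
  if_neg hs

lemma mul_mem_of_mem (hρ : ρ ∈ Ioo 0 1) {s : ℝ} (hs : s ∈ Ioo 0 (Real.pi / 2)) :
    ρ * s ∈ Ioo 0 (Real.pi / 2) :=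
  ⟨mul_pos hρ.1 hs.1, lt_trans (mul_lt_of_lt_one_left hs.1 hρ.2) hs.2⟩

/-- The excess is positive because `tan (ρ s) ≤ tan s`. -/
lemma excess_pos (hκ : 0 < κ) (hρ : ρ ∈ Ioo 0 1) (hr : r ∈ Ioo 0 1) {s : ℝ}
    (hs : s ∈ Ioo (-(Real.pi / 2)) (Real.pi / 2)) : 0 < excess κ ρ r s := by
  by_cases hs0 : s = 0
  · simp [excess, hs0]
  rw [← excess_abs]
  have ht : |s| ∈ Ioo 0 (Real.pi / 2) := ⟨abs_pos.mpr hs0, abs_lt.mpr hs⟩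
  generalize |s| = t at ht
  have hρt := mul_mem_of_mem hρ ht
  rw [excess_of_ne ht.1.ne']
  have hcos : 0 < Real.cos t := Real.cos_pos_of_mem_Ioo ⟨by linarith [ht.1, Real.pi_pos], ht.2⟩
  have hsin := sin_pos_of_mem hρt
  have h1 : 0 ≤ Real.sin (t - ρ * t) :=
    Real.sin_nonneg_of_nonneg_of_le_pi (by nlinarith [hρ.2, ht.1])
      (by linarith [hρt.1, ht.2, Real.pi_pos])
  rw [Real.sin_sub] at h1
  have h2 : 1 ≤ Real.cos (ρ * t) / Real.sin (ρ * t) * (Real.sin t / Real.cos t) := by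
    rw [div_mul_div_comm, one_le_div (mul_pos hsin hcos)]
    linarith
  have h3 : 0 < 1 - r ^ 2 := by nlinarith [hr.1, hr.2]
  have h4 : 0 < (1 - r ^ 2) * κ ^ 2 * ρ / Real.cos t ^ 2 := by
    have := hρ.1
    positivity
  exact mul_pos h4 (by linarith [hρ.2])

lemma excess_le_of_pos (hρ : ρ ∈ Ioo 0 1) (hr : r ∈ Ioo 0 1) {s : ℝ}
    (hs : s ∈ Ioo 0 (Real.pi / 2)) :
    excess κ ρ r s ≤
      ρ * Real.cot (ρ * s) * ((1 - r ^ 2) * κ ^ 2 * Real.sin s / Real.cos s ^ 3) := by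
  have h3 : 0 < 1 - r ^ 2 := by nlinarith [hr.1, hr.2]
  have hcos : 0 < Real.cos s := Real.cos_pos_of_mem_Ioo ⟨by linarith [hs.1, Real.pi_pos], hs.2⟩
  have hρ0 := hρ.1
  rw [excess_of_ne hs.1.ne', Real.cot_eq_cos_div_sin]
  have e : ρ * (Real.cos (ρ * s) / Real.sin (ρ * s)) *
      ((1 - r ^ 2) * κ ^ 2 * Real.sin s / Real.cos s ^ 3) =
      (1 - r ^ 2) * κ ^ 2 * ρ / Real.cos s ^ 2 *
        (Real.cos (ρ * s) / Real.sin (ρ * s) * (Real.sin s / Real.cos s)) := by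
    field_simp
  rw [e]
  exact mul_le_mul_of_nonneg_left (by linarith) (by positivity)

lemma excess_le (hρ : ρ ∈ Ioo 0 1) (hr : r ∈ Ioo 0 1) {s : ℝ} (hs0 : s ≠ 0)
    (hs : s ∈ Ioo (-(Real.pi / 2)) (Real.pi / 2)) :
    excess κ ρ r s ≤ (1 - r ^ 2) * κ ^ 2 / Real.cos s ^ 3 := by
  rw [← excess_abs, ← Real.cos_abs s]
  have ht : |s| ∈ Ioo 0 (Real.pi / 2) := ⟨abs_pos.mpr hs0, abs_lt.mpr hs⟩
  generalize |s| = t at ht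
  refine (excess_le_of_pos hρ hr ht).trans ?_
  have h3 : 0 < 1 - r ^ 2 := by nlinarith [hr.1, hr.2]
  have hcos : 0 < Real.cos t := Real.cos_pos_of_mem_Ioo ⟨by linarith [ht.1, Real.pi_pos], ht.2⟩
  have hρt := mul_mem_of_mem hρ ht
  -- `ρ t cot (ρ t) ≤ 1` and `sin t ≤ t`
  have h1 : ρ * Real.cot (ρ * t) * Real.sin t ≤ 1 := by
    have hc := cot_pos hρt
    have hlt : ρ * t < Real.tan (ρ * t) := Real.lt_tan hρt.1 hρt.2
    have htc : Real.tan (ρ * t) * Real.cot (ρ * t) = 1 := by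
      rw [Real.tan_eq_sin_div_cos, Real.cot_eq_cos_div_sin]
      have a1 := (sin_pos_of_mem hρt).ne'
      have a2 : Real.cos (ρ * t) ≠ 0 :=
        (Real.cos_pos_of_mem_Ioo ⟨by linarith [hρt.1, Real.pi_pos], hρt.2⟩).ne'
      field_simp
    have hs' := Real.sin_le ht.1.le
    calc ρ * Real.cot (ρ * t) * Real.sin t ≤ ρ * Real.cot (ρ * t) * t :=
          mul_le_mul_of_nonneg_left hs' (mul_nonneg hρ.1.le hc.le)
      _ = ρ * t * Real.cot (ρ * t) := by ring
      _ ≤ Real.tan (ρ * t) * Real.cot (ρ * t) := mul_le_mul_of_nonneg_right hlt.le hc.le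
      _ = 1 := htc
  calc ρ * Real.cot (ρ * t) * ((1 - r ^ 2) * κ ^ 2 * Real.sin t / Real.cos t ^ 3)
      = ρ * Real.cot (ρ * t) * Real.sin t * ((1 - r ^ 2) * κ ^ 2 / Real.cos t ^ 3) := by ring
    _ ≤ 1 * ((1 - r ^ 2) * κ ^ 2 / Real.cos t ^ 3) :=
        mul_le_mul_of_nonneg_right h1 (by positivity)
    _ = _ := one_mul _

lemma measurable_excess : Measurable (excess κ ρ r) := by
  unfold excess
  refine Measurable.ite (measurableSet_singleton 0) measurable_const ?_
  fun_prop

lemma integrableOn_excess_phase (hκ : 0 < κ) (hρ : ρ ∈ Ioo 0 1) (hr : r ∈ Ioo 0 1) (c e : ℝ) :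
    IntegrableOn (fun x => excess κ ρ r (phase κ r x)) (Ioo c e) := by
  have h3 : 0 < 1 - r ^ 2 := by nlinarith [hr.1, hr.2]
  have hm : Measurable fun x => excess κ ρ r (phase κ r x) :=
    measurable_excess.comp continuous_phase.measurable
  refine Measure.integrableOn_of_bounded (M := 1 + (1 - r ^ 2) * κ ^ 2 / √(1 - r ^ 2) ^ 3)
    (by simp) hm.aestronglyMeasurable (Filter.Eventually.of_forall fun x => ?_)
  rw [Real.norm_eq_abs, abs_of_pos (excess_pos hκ hρ hr (phase_mem hr x))]
  by_cases h0 : phase κ r x = 0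
  · simp only [excess, h0, if_true]
    have : 0 ≤ (1 - r ^ 2) * κ ^ 2 / √(1 - r ^ 2) ^ 3 := by positivity
    linarith
  · refine (excess_le hρ hr h0 (phase_mem hr x)).trans ?_
    have hle : √(1 - r ^ 2) ≤ Real.cos (phase κ r x) := by
      refine Real.sqrt_le_iff.mpr ⟨(cos_phase_pos hr x).le, ?_⟩
      rw [cos_sq_phase hr]
      nlinarith [mul_nonneg (sq_nonneg r) (sq_nonneg (Real.sin (κ * x)))]
    have hs : 0 < √(1 - r ^ 2) := Real.sqrt_pos.mpr h3
    have : (1 - r ^ 2) * κ ^ 2 / Real.cos (phase κ r x) ^ 3 ≤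
        (1 - r ^ 2) * κ ^ 2 / √(1 - r ^ 2) ^ 3 := by gcongr
    linarith

/-- `U = sin (ρ S)`, with `S` the phase, solves `U'' + ((ρ κ)² + excess) U = 0`. -/
lemma isSystemSolution_phase (hρ : ρ ∈ Ioo 0 1) (hr : r ∈ Ioo 0 1) (L : ℝ) :
    IsSystemSolution L (fun x => (ρ * κ) ^ 2 + excess κ ρ r (phase κ r x))
      (fun x => Real.sin (ρ * phase κ r x))
      (fun x => ρ * phaseDeriv κ r x * Real.cos (ρ * phase κ r x)) := by
  have hS : ∀ x, HasDerivAt (fun x => ρ * phase κ r x) (ρ * phaseDeriv κ r x) x := fun x =>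
    (hasDerivAt_phase hr x).const_mul ρ
  have hS1c : Continuous (phaseDeriv κ r) :=
    continuous_iff_continuousAt.mpr fun x => (hasDerivAt_phaseDeriv hr x).continuousAt
  have hSc := continuous_phase (κ := κ) (r := r)
  have hne : ∀ x, Real.cos (phase κ r x) ^ 3 ≠ 0 := fun x =>
    pow_ne_zero 3 (cos_phase_pos hr x).ne'
  constructor
  · refine .of_hasDerivAt (fun x => ?_) (by fun_prop)
    exact (hS x).sin.congr_deriv (by ring)
  · set f : ℝ → ℝ := fun x =>
      ρ * -((1 - r ^ 2) * κ ^ 2 * Real.sin (phase κ r x) / Real.cos (phase κ r x) ^ 3) *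
        Real.cos (ρ * phase κ r x) +
      ρ * phaseDeriv κ r x * (-Real.sin (ρ * phase κ r x) * (ρ * phaseDeriv κ r x))
    have hfc : Continuous f := by
      refine ((continuous_const.mul (Continuous.neg ?_)).mul (by fun_prop)).add (by fun_prop)
      exact Continuous.div (by fun_prop) (by fun_prop) hne
    have hf : (fun x => -(((ρ * κ) ^ 2 + excess κ ρ r (phase κ r x)) *
        Real.sin (ρ * phase κ r x))) = f := by
      ext x
      simp only [f]
      have e1 : ρ * phaseDeriv κ r x * (-Real.sin (ρ * phase κ r x) * (ρ * phaseDeriv κ r x)) =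
          -(ρ ^ 2 * Real.sin (ρ * phase κ r x)) * phaseDeriv κ r x ^ 2 := by ring
      rw [e1, phaseDeriv_sq hr]
      have hc := (cos_phase_pos (κ := κ) hr x).ne'
      by_cases h0 : phase κ r x = 0
      · simp [h0]
      have hs : Real.sin (ρ * phase κ r x) ≠ 0 := by
        have hm := phase_mem (κ := κ) hr x
        intro hsin
        have hz := (Real.sin_eq_zero_iff_of_lt_of_lt (by nlinarith [hm.1, hρ.1, hρ.2, Real.pi_pos])
          (by nlinarith [hm.2, hρ.1, hρ.2, Real.pi_pos])).mp hsin
        exact (mul_ne_zero hρ.1.ne' h0) hz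
      rw [excess_of_ne h0]
      field_simp
      ring
    rw [hf]
    refine .of_hasDerivAt (fun x => ?_) hfc
    exact ((hasDerivAt_phaseDeriv hr x).const_mul ρ).mul (hS x).cos

/-- Mass of the excess over a quarter period, cut at `x₁`. Left of `x₁` the cotangent factor is at
most its value at `x₁` and the other factor integrates to at most `κ`; right of `x₁` the excess is
uniformly small as `r → 1`. -/
lemma integral_excess_le (hκ : 0 < κ) (hρ : ρ ∈ Ioo 0 1) (hr : r ∈ Ioo 0 1) {x₁ h : ℝ}
    (hx₁ : x₁ ∈ Ioo 0 h) (hh : κ * h = Real.pi / 2) :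
    ∫ x in Ioo 0 h, excess κ ρ r (phase κ r x) ≤
      ρ * κ * Real.cot (ρ * phase κ r x₁) + h * ((1 - r ^ 2) * κ ^ 2 / Real.sin (κ * x₁) ^ 3) := by
  have h3 : 0 < 1 - r ^ 2 := by nlinarith [hr.1, hr.2]
  have hS0 : ∀ x ∈ Ico 0 h, phase κ r x ∈ Ioo 0 (Real.pi / 2) := by
    intro x hx
    refine ⟨Real.arcsin_pos.mpr (mul_pos hr.1 (Real.cos_pos_of_mem_Ioo ⟨?_, ?_⟩)),
      (phase_mem hr x).2⟩
    · nlinarith [hx.1, Real.pi_pos]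
    · rw [← hh]; exact mul_lt_mul_of_pos_left hx.2 hκ
  have hi := fun c e => integrableOn_excess_phase hκ hρ hr c e
  have hii : ∀ c e, IntervalIntegrable (fun x => excess κ ρ r (phase κ r x)) volume c e :=
    fun c e => by
      rcases le_total c e with hce | hce
      · exact (intervalIntegrable_iff_integrableOn_Ioo_of_le hce).mpr (hi c e)
      · exact ((intervalIntegrable_iff_integrableOn_Ioo_of_le hce).mpr (hi e c)).symm
  rw [← integral_Ioc_eq_integral_Ioo, ← intervalIntegral.integral_of_le (by linarith [hx₁.1, hx₁.2]),
    ← intervalIntegral.integral_add_adjacent_intervals (hii 0 x₁) (hii x₁ h)]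
  have hsin₁ : 0 < Real.sin (κ * x₁) := by
    refine sin_pos_of_mem ⟨mul_pos hκ hx₁.1, ?_⟩
    rw [← hh]; exact mul_lt_mul_of_pos_left hx₁.2 hκ
  refine add_le_add ?_ ?_
  · set C := ρ * Real.cot (ρ * phase κ r x₁)
    have hρS := mul_mem_of_mem hρ (hS0 x₁ ⟨hx₁.1.le, hx₁.2⟩)
    have hC : 0 ≤ C := mul_nonneg hρ.1.le (cot_pos hρS).le
    set g : ℝ → ℝ := fun x =>
      (1 - r ^ 2) * κ ^ 2 * Real.sin (phase κ r x) / Real.cos (phase κ r x) ^ 3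
    have hgc : Continuous g := by
      have hSc := continuous_phase (κ := κ) (r := r)
      exact Continuous.div (by fun_prop) (by fun_prop) fun x =>
        pow_ne_zero 3 (cos_phase_pos hr x).ne'
    have hmono : ∫ x in (0:ℝ)..x₁, excess κ ρ r (phase κ r x) ≤ ∫ x in (0:ℝ)..x₁, C * g x := by
      refine intervalIntegral.integral_mono_on hx₁.1.le (hii _ _)
        ((continuous_const.mul hgc).intervalIntegrable _ _) fun x hx => ?_
      have hSx := hS0 x ⟨hx.1, hx.2.trans_lt hx₁.2⟩
      refine (excess_le_of_pos hρ hr hSx).trans ?_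
      have hg0 : 0 ≤ g x := by
        have a1 := sin_pos_of_mem hSx
        have a2 := cos_phase_pos (κ := κ) hr x
        simp only [g]; positivity
      refine mul_le_mul_of_nonneg_right (mul_le_mul_of_nonneg_left ?_ hρ.1.le) hg0
      refine cot_le_cot hρS.1 (mul_le_mul_of_nonneg_left ?_ hρ.1.le) (mul_mem_of_mem hρ hSx).2
      refine Real.monotone_arcsin (mul_le_mul_of_nonneg_left ?_ hr.1.le)
      refine Real.cos_le_cos_of_nonneg_of_le_pi (mul_nonneg hκ.le hx.1) ?_
        (mul_le_mul_of_nonneg_left hx.2 hκ.le)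
      nlinarith [mul_lt_mul_of_pos_left hx₁.2 hκ, Real.pi_pos]
    have hint : ∫ x in (0:ℝ)..x₁, g x = phaseDeriv κ r 0 - phaseDeriv κ r x₁ := by
      have := intervalIntegral.integral_eq_sub_of_hasDerivAt (a := 0) (b := x₁)
        (fun x _ => hasDerivAt_phaseDeriv (κ := κ) hr x) (hgc.neg.intervalIntegrable _ _)
      rw [intervalIntegral.integral_neg] at this
      linarith
    have hle : phaseDeriv κ r 0 - phaseDeriv κ r x₁ ≤ κ := by
      have h0 : phaseDeriv κ r 0 = 0 := by simp [phaseDeriv]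
      have h1 : phaseDeriv κ r x₁ ^ 2 ≤ κ ^ 2 := by
        rw [phaseDeriv_sq hr]
        have : 0 ≤ (1 - r ^ 2) * κ ^ 2 / Real.cos (phase κ r x₁) ^ 2 := by positivity
        linarith
      linarith [(abs_le.mp (abs_le_of_sq_le_sq h1 hκ.le)).1]
    refine hmono.trans ?_
    rw [intervalIntegral.integral_const_mul, hint]
    calc C * (phaseDeriv κ r 0 - phaseDeriv κ r x₁) ≤ C * κ := mul_le_mul_of_nonneg_left hle hC
      _ = _ := by simp only [C]; ring
  · set K := (1 - r ^ 2) * κ ^ 2 / Real.sin (κ * x₁) ^ 3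
    have hK : 0 ≤ K := by positivity
    have hmono : ∫ x in x₁..h, excess κ ρ r (phase κ r x) ≤ ∫ _ in x₁..h, K := by
      refine intervalIntegral.integral_mono_on_of_le_Ioo hx₁.2.le (hii _ _)
        (continuous_const.intervalIntegrable _ _) fun x hx => ?_
      have hSx := hS0 x ⟨hx₁.1.le.trans hx.1.le, hx.2⟩
      refine (excess_le hρ hr hSx.1.ne' (phase_mem hr x)).trans ?_
      have hsle : Real.sin (κ * x₁) ≤ Real.cos (phase κ r x) := by
        have b1 : Real.sin (κ * x₁) ≤ Real.sin (κ * x) :=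
          Real.sin_le_sin_of_le_of_le_pi_div_two
            (by nlinarith [mul_pos hκ hx₁.1, Real.pi_pos])
            (by rw [← hh]; exact mul_le_mul_of_nonneg_left hx.2.le hκ.le)
            (mul_le_mul_of_nonneg_left hx.1.le hκ.le)
        refine b1.trans (abs_le_of_sq_le_sq' ?_ (cos_phase_pos hr x).le).2
        rw [cos_sq_phase hr]
        nlinarith [Real.sin_sq_le_one (κ * x)]
      simp only [K]
      gcongr
    refine hmono.trans ?_
    rw [intervalIntegral.integral_const, smul_eq_mul]
    exact mul_le_mul_of_nonneg_right (by linarith [hx₁.1]) hK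

end phase

/-- By periodicity and evenness the mass on `(0, L)` is `2n + 2` times that on a quarter period. -/
lemma integral_excess_eq {ρ r : ℝ} (hρ : ρ ∈ Ioo 0 1) (hr : r ∈ Ioo 0 1) {κ h : ℝ} (hκ : 0 < κ)
    (hh : κ * h = Real.pi / 2) (n : ℕ) :
    ∫ x in Ioo 0 ((2 * n + 2) * h), excess κ ρ r (phase κ r x) =
      (2 * n + 2) * ∫ x in Ioo 0 h, excess κ ρ r (phase κ r x) := by
  have hh0 : 0 < h := pos_of_mul_pos_right (hh ▸ Real.pi_div_two_pos) hκ.le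
  set p : ℝ → ℝ := fun x => excess κ ρ r (phase κ r x)
  have hii : ∀ c e, IntervalIntegrable p volume c e :=
    fun c e => by
      rcases le_total c e with hce | hce
      · exact (intervalIntegrable_iff_integrableOn_Ioo_of_le hce).mpr
          (integrableOn_excess_phase hκ hρ hr c e)
      · exact ((intervalIntegrable_iff_integrableOn_Ioo_of_le hce).mpr
          (integrableOn_excess_phase hκ hρ hr e c)).symm
  have hper : Function.Periodic p (2 * h) := fun x => by
    have : phase κ r (x + 2 * h) = -phase κ r x := by
      rw [phase, phase, ← Real.arcsin_neg, ← mul_neg, ← Real.cos_add_pi]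
      congr 3
      linarith
    simp only [p, this, excess_neg]
  have heven : ∀ x, p (-x) = p x := fun x => by simp only [p, phase, mul_neg, Real.cos_neg]
  have e1 : ∫ x in (0:ℝ)..(2 * n + 2) * h, p x = (n + 1) * ∫ x in (0:ℝ)..2 * h, p x := by
    have := hper.intervalIntegral_add_zsmul_eq (n + 1) 0 hii
    simp only [zero_add, zsmul_eq_mul] at this
    push_cast at this
    rw [← this]
    congr 1; ring
  have e2 : ∫ x in (0:ℝ)..2 * h, p x = ∫ x in (-h)..h, p x := by
    have := hper.intervalIntegral_add_eq 0 (-h)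
    rw [zero_add, show -h + 2 * h = h by ring] at this
    exact this
  have e3 : ∫ x in (-h)..0, p x = ∫ x in (0:ℝ)..h, p x := by
    have := intervalIntegral.integral_comp_neg (a := 0) (b := h) p
    rw [neg_zero] at this
    rw [← this]
    simp only [heven]
  rw [← intervalIntegral.integral_add_adjacent_intervals (hii (-h) 0) (hii 0 h), e3] at e2
  rw [← integral_Ioc_eq_integral_Ioo, ← integral_Ioc_eq_integral_Ioo,
    ← intervalIntegral.integral_of_le (by positivity), ← intervalIntegral.integral_of_le hh0.le,
    e1, e2]
  ring

/-- The resonant potentials built from `phase` bound the Lyapunov constant. -/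
lemma lyapunovConst_le_of_cut {n : ℕ} (hn : 1 ≤ n) {L : ℝ} (hL : 0 < L) {r x₁ : ℝ}
    (hr : r ∈ Ioo 0 1) (hx₁ : x₁ ∈ Ioo 0 (L / (2 * n + 2))) :
    lyapunovConst n L ≤ (2 * n + 2) *
      (freq n L * Real.cot (n / (n + 1) * phase (freq (n + 1) L) r x₁) + L / (2 * n + 2) *
        ((1 - r ^ 2) * freq (n + 1) L ^ 2 / Real.sin (freq (n + 1) L * x₁) ^ 3)) := by
  have hn0 : (0:ℝ) < n := by exact_mod_cast hn
  set κ := freq (n + 1) L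
  have hκ : 0 < κ := freq_pos (by omega) hL
  set ρ : ℝ := n / (n + 1)
  have hρ : ρ ∈ Ioo (0:ℝ) 1 := ⟨by positivity, (div_lt_one (by positivity)).mpr (by linarith)⟩
  set h := L / (2 * n + 2)
  have hh : κ * h = Real.pi / 2 := by
    simp only [κ, h, freq]; push_cast; field_simp
  have hh0 : 0 < h := by positivity
  have hL' : (2 * n + 2) * h = L := by simp only [h]; field_simp
  have hρκ : ρ * κ = freq n L := by
    simp only [κ, ρ, freq]; push_cast; field_simp
  set a : ℝ → ℝ := fun x => (ρ * κ) ^ 2 + excess κ ρ r (phase κ r x)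
  have hsub : ∀ x, a x - neumannEigenvalue n L = excess κ ρ r (phase κ r x) := fun x => by
    simp only [a]; rw [neumannEigenvalue_eq, hρκ]; ring
  have hpos : ∀ x, 0 < excess κ ρ r (phase κ r x) := fun x => excess_pos hκ hρ hr (phase_mem hr x)
  have hlt : ∀ x, neumannEigenvalue n L < a x := fun x => by linarith [hsub x, hpos x]
  have hnorm : normL1 0 L (fun x => a x - neumannEigenvalue n L) =
      (2 * n + 2) * ∫ x in Ioo 0 h, excess κ ρ r (phase κ r x) := by
    rw [← integral_excess_eq hρ hr hκ hh, hL']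
    simp only [normL1, hsub, abs_of_pos (hpos _)]
  have hmem : a ∈ resonantSet n L := by
    refine ⟨⟨(integrableOn_const (by simp)).add (integrableOn_excess_phase hκ hρ hr 0 L),
      Filter.Eventually.of_forall fun x => (hlt x).le, ?_⟩,
      _, (isSystemSolution_phase hρ hr L).isNeumannSolution hL ?_ ?_, ?_⟩
    · simp only [hlt, and_true, ofPred_mem_eq, Real.volume_Ioo, ENNReal.ofReal_pos]
      linarith
    · simp [phaseDeriv]
    · have : Real.sin (κ * L) = 0 := by
        rw [show κ * L = ((n + 1 : ℕ) : ℝ) * Real.pi by simp only [κ, freq]; field_simp]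
        exact Real.sin_nat_mul_pi _
      simp [phaseDeriv, this]
    · intro htriv
      rw [IsTrivial, ae_restrict_iff' measurableSet_Ioo] at htriv
      have hz : volume (Ioo 0 h) = 0 := by
        refine measure_eq_zero_iff_ae_notMem.mpr ?_
        filter_upwards [htriv] with x hx hxm
        have hxL : x ∈ Ioo 0 L := ⟨hxm.1, by nlinarith [hxm.2]⟩
        refine (sin_pos_of_mem (mul_mem_of_mem hρ ⟨Real.arcsin_pos.mpr (mul_pos hr.1
          (Real.cos_pos_of_mem_Ioo ⟨?_, ?_⟩)), (phase_mem hr x).2⟩)).ne' (hx hxL)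
        · nlinarith [mul_pos hκ hxm.1, Real.pi_pos]
        · rw [← hh]; exact mul_lt_mul_of_pos_left hxm.2 hκ
      simp at hz
      linarith
  have hle : lyapunovConst n L ≤ normL1 0 L (fun x => a x - neumannEigenvalue n L) :=
    csInf_le ⟨0, by rintro _ ⟨b, _, rfl⟩; exact integral_nonneg fun _ => abs_nonneg _⟩
      ⟨a, hmem, rfl⟩
  rw [hnorm] at hle
  refine hle.trans (mul_le_mul_of_nonneg_left ?_ (by positivity))
  rw [← hρκ]
  exact integral_excess_le hκ hρ hr hx₁ hh

/-- Letting `r → 1` and then `x₁ → 0` in `lyapunovConst_le_of_cut`. -/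
theorem lyapunovConst_le {n : ℕ} (hn : 1 ≤ n) {L : ℝ} (hL : 0 < L) :
    lyapunovConst n L ≤ equalPartitionBound n L := by
  have hn0 : (0:ℝ) < n := by exact_mod_cast hn
  have hκ : 0 < freq (n + 1) L := freq_pos (by omega) hL
  have hν : 0 < freq n L := freq_pos hn hL
  set κ := freq (n + 1) L
  set ν := freq n L
  set ρ : ℝ := n / (n + 1)
  have hρ : ρ ∈ Ioo (0:ℝ) 1 := ⟨by positivity, (div_lt_one (by positivity)).mpr (by linarith)⟩
  set h := L / (2 * n + 2)
  have hh : κ * h = Real.pi / 2 := by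
    simp only [κ, h, freq]; push_cast; field_simp
  have hh0 : 0 < h := by positivity
  have hρκ : ρ * κ = ν := by
    simp only [κ, ρ, ν, freq]; push_cast; field_simp
  have hlim : ∀ x₁ ∈ Ioo 0 h,
      lyapunovConst n L ≤ (2 * n + 2) * (ν * Real.cot (ρ * (Real.pi / 2 - κ * x₁))) := by
    intro x₁ hx₁
    have hκx : κ * x₁ ∈ Ioo 0 (Real.pi / 2) :=
      ⟨mul_pos hκ hx₁.1, by rw [← hh]; exact mul_lt_mul_of_pos_left hx₁.2 hκ⟩
    have hph : phase κ 1 x₁ = Real.pi / 2 - κ * x₁ := by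
      rw [phase, one_mul, ← Real.sin_pi_div_two_sub, Real.arcsin_sin] <;>
        linarith [hκx.1, hκx.2]
    have hmem : ρ * phase κ 1 x₁ ∈ Ioo 0 (Real.pi / 2) :=
      mul_mem_of_mem hρ (by rw [hph]; exact ⟨by linarith [hκx.2], by linarith [hκx.1]⟩)
    have hcont : ContinuousAt (fun r : ℝ => (2 * n + 2) *
        (ν * Real.cot (ρ * phase κ r x₁) + h *
        ((1 - r ^ 2) * κ ^ 2 / Real.sin (κ * x₁) ^ 3))) 1 := by
      have hp : Continuous fun r : ℝ => ρ * phase κ r x₁ := by unfold phase; fun_prop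
      have hcot : ContinuousAt (fun r : ℝ => Real.cot (ρ * phase κ r x₁)) 1 :=
        ContinuousAt.comp (f := fun r : ℝ => ρ * phase κ r x₁)
          (hasDerivAt_cot (sin_pos_of_mem hmem).ne').continuousAt hp.continuousAt
      refine continuousAt_const.mul ((continuousAt_const.mul hcot).add ?_)
      exact Continuous.continuousAt (by fun_prop)
    have ht := (hcont.tendsto).mono_left (nhdsWithin_le_nhds (s := Iio 1))
    have hev : ∀ᶠ r in nhdsWithin (1:ℝ) (Iio 1), r ∈ Ioo (0:ℝ) 1 := Ioo_mem_nhdsLT one_pos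
    have := ge_of_tendsto ht (hev.mono fun r hr => lyapunovConst_le_of_cut hn hL hr hx₁)
    simpa [hph] using this
  have hm : ρ * (Real.pi / 2 - κ * 0) = ν * h := by
    rw [← hρκ, mul_zero, sub_zero, ← hh]; ring
  have hcont : ContinuousAt (fun x₁ : ℝ =>
      (2 * (n:ℝ) + 2) * (ν * Real.cot (ρ * (Real.pi / 2 - κ * x₁)))) 0 := by
    have hcot : ContinuousAt (fun x₁ : ℝ => Real.cot (ρ * (Real.pi / 2 - κ * x₁))) 0 :=
      ContinuousAt.comp (f := fun x₁ : ℝ => ρ * (Real.pi / 2 - κ * x₁))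
        (hasDerivAt_cot (by rw [hm]; exact
          (sin_pos_of_mem (freq_mul_equal_piece_mem hn hL)).ne')).continuousAt
        (Continuous.continuousAt (by fun_prop))
    exact continuousAt_const.mul (continuousAt_const.mul hcot)
  have ht := (hcont.tendsto).mono_left (nhdsWithin_le_nhds (s := Ioi 0))
  have hev : ∀ᶠ x in nhdsWithin (0:ℝ) (Ioi 0), x ∈ Ioo (0:ℝ) h := Ioo_mem_nhdsGT hh0
  have := ge_of_tendsto ht (hev.mono hlim)
  rwa [hm] at this

end NeumannLyapunov

end

theorem theoremt111207 (n : ℕ) (hn : 1 ≤ n) (L : ℝ) (hL : 0 < L) :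
    (∀ a : ℝ → ℝ, NeumannLyapunov.Admissible n L a →
      NeumannLyapunov.PartitionCondition n L a →
        ∀ u : ℝ → ℝ, NeumannLyapunov.IsNeumannSolution L a u → NeumannLyapunov.IsTrivial L u) ∧
    (∀ a : ℝ → ℝ, NeumannLyapunov.GlobalCondition n L a →
      NeumannLyapunov.PartitionCondition n L a) ∧
    (∀ y : Fin (2 * n + 3) → ℝ, NeumannLyapunov.IsFinePartition n L y →
      (∃ i j : Fin (2 * n + 2), y i.succ - y i.castSucc ≠ y j.succ - y j.castSucc) →
        ∃ a : ℝ → ℝ, NeumannLyapunov.Admissible n L a ∧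
          NeumannLyapunov.SmallOnPieces n L y a ∧
          NeumannLyapunov.PartitionCondition n L a ∧
          ¬ NeumannLyapunov.GlobalCondition n L a) := by
  refine ⟨fun a ha hP u hu => NeumannLyapunov.isTrivial_of_partitionCondition hn hL ha hP hu,
    fun a ha => NeumannLyapunov.partitionCondition_of_normL1_lt hn hL ha.1.1
      (ha.2.trans_le (NeumannLyapunov.lyapunovConst_le hn hL)), fun y hy hne => ?_⟩
  obtain ⟨a, ha, hsmall, hnorm⟩ :=
    NeumannLyapunov.exists_admissible_smallOnPieces hn hL hy hne
  exact ⟨a, ha, hsmall, ⟨y, hy, hsmall⟩, fun hG =>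
    (hG.2.trans_le (NeumannLyapunov.lyapunovConst_le hn hL)).ne hnorm⟩
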